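/- Let $k=\mathbb{C}$, let $p$ be a prime, and for each integer $t\ge 1$ let $r_t\in\mathbb{C}$ be a primitive $p^{2t}$-th root of unity, with $r_t=r_{t+1}^{p^2}$ for all $t$. For integers $n,t\ge 1$ let $A_{nt}$ be the $k$-algebra with generators $x_{1t},\dots,x_{nt}$ and relations $x_{it}x_{jt}=r_t\,x_{jt}x_{it}$ for $1\le i<j\le n$. The rules $\Phi_{nt}\colon A_{nt}\to A_{n,t+1}$, $x_{it}\mapsto x_{i,t+1}^{\,p}$, and $\Psi_{nt}\colon A_{nt}\to A_{n+1,t}$, $x_{it}\mapsto x_{it}$ ($1\le i\le n$), define injective $k$-algebra homomorphisms, compatible with each other. Identifying the algebras along these embeddings, put $A_n=\bigcup_{t\ge1}A_{nt}$ and $A=\bigcup_{n\ge1}A_n$ (each $A_{nt}$ embeds in $A$). Then $A$ is an Ore domain; let $D$ be its quotient division ring. Inside $D$, let $D_n$ be the division subring generated by $A_n$. Then $D_n=\{ab^{-1}: a,b\in A_n,\ b\neq0\}$ is the quotient division ring of $A_n$, $D_n\subseteq D_{n+1}$, and $D=\bigcup_{n\ge1}D_n$. Moreover: 1. The center $Z(D)$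 of $D$ is $k$. 2. $D$ is weakly locally finite: for every finite subset $S\subseteq D$ the division subring of $D$ generated by $S$ is finite dimensional over its own center. 3. $\mathrm{GKdim}_k D=\infty$, where $\mathrm{GKdim}_k D=\sup_V\limsup_{r\to\infty}\log_r\dim_k V^r$, with $V$ running over all finite dimensional $k$-subspaces of $D$ containing $1$ and $V^r$ the span of all products of $r$ elements of $V$. 4. $D$ is not algebraic over $Z(D)$. In particular, $D$ is not locally finite, i.e. there is a finite subset $S\subseteq D$ such that the division subring generated by $Z(D)\cup S$ is infinite dimensional over $Z(D)$. -/

import Mathlib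

/-! ### Division rings: finiteness conditions over the center -/

/-- A division ring is centrally finite if it is a finite dimensional vector space over its
center. -/
def IsCentrallyFinite (D : Type*) [DivisionRing D] : Prop :=
  Module.Finite (Subring.center D) D

/-- A division ring is weakly locally finite if every finite subset generates a centrally finite
division subring (`Subfield.closure S` is the division subring of `D` generated by `S`; in Mathlib
a `Subfield` of a division ring need not be commutative). -/
def IsWeaklyLocallyFinite (D : Type*) [DivisionRing D] : Prop :=
  ∀ S : Set D, S.Finite → IsCentrallyFinite (Subfield.closure S)

/-- The division subring `F(S)` of `D` generated by `S` over the center `F` of `D`, as an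
`F`-subspace of `D`. -/
def divisionClosureOverCenter {D : Type*} [DivisionRing D] (S : Set D) :
    Submodule (Subring.center D) D where
  carrier := Subfield.closure ((Subring.center D : Set D) ∪ S)
  add_mem' := fun ha hb => add_mem ha hb
  zero_mem' := zero_mem _
  smul_mem' := fun c _ hx =>
    mul_mem (Subfield.subset_closure (Set.mem_union_left _ c.2)) hx

/-- A division ring `D` with center `F` is locally finite if `F(S)` is a finite dimensional
`F`-vector space for every finite subset `S` of `D`. -/
def IsLocallyFiniteDivisionRing (D : Type*) [DivisionRing D] : Prop :=
  ∀ S : Set D, S.Finite → Module.Finite (Subring.center D) (divisionClosureOverCenter S)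

/-! ### Gelfand-Kirillov dimension -/

/-- The Gelfand-Kirillov dimension of a `k`-algebra `A`: the supremum, over all finite dimensional
subspaces `V` of `A` containing `1`, of `limsup_r log_r (dim_k V ^ r)`. Here `V ^ r` is the span of
all products of `r` elements of `V`. -/
noncomputable def gelfandKirillovDim (k A : Type*) [Field k] [Ring A] [Algebra k A] : EReal :=
  ⨆ (V : Submodule k A) (_ : (1 : A) ∈ V) (_ : Module.Finite k V),
    Filter.limsup
      (fun r : ℕ => ((Real.logb (r : ℝ) (Module.finrank k (V ^ r : Submodule k A) : ℝ) : ℝ) : EReal))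
      Filter.atTop

/-! ### Ore domains and quotient division rings -/

/-- A (two-sided) Ore domain: a domain in which any two nonzero elements have a nonzero common
right multiple and a nonzero common left multiple. -/
def IsOreDomain (A : Type*) [Ring A] : Prop :=
  IsDomain A ∧ ∀ a b : A, a ≠ 0 → b ≠ 0 →
    (∃ c d : A, a * c = b * d ∧ a * c ≠ 0) ∧ (∃ c d : A, c * a = d * b ∧ c * a ≠ 0)

/-- `ι : A → D` exhibits the division ring `D` as the quotient division ring of `A`: it is
injective and every element of `D` is a fraction `ι a * (ι b)⁻¹` with `a, b ∈ A`, `b ≠ 0`. -/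
def IsQuotientDivisionRing {A D : Type*} [Ring A] [DivisionRing D] (ι : A →+* D) : Prop :=
  Function.Injective ι ∧ ∀ d : D, ∃ a b : A, b ≠ 0 ∧ d = ι a * (ι b)⁻¹

/-! ### The algebras `A_{nt}` -/

/-- The relations `x_i x_j = q x_j x_i`, `i < j`. -/
inductive QuantumRel (n : ℕ) (q : ℂ) :
    FreeAlgebra ℂ (Fin n) → FreeAlgebra ℂ (Fin n) → Prop
  | comm (i j : Fin n) (h : i < j) :
      QuantumRel n q (FreeAlgebra.ι ℂ i * FreeAlgebra.ι ℂ j)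
        (q • (FreeAlgebra.ι ℂ j * FreeAlgebra.ι ℂ i))

/-- The `ℂ`-algebra on generators `x_1, …, x_n` with relations `x_i x_j = q x_j x_i` for `i < j`. -/
abbrev QuantumAffine (n : ℕ) (q : ℂ) : Type := RingQuot (QuantumRel n q)

namespace QuantumAffine

/-- The generator `x_i`. -/
noncomputable def gen (n : ℕ) (q : ℂ) (i : Fin n) : QuantumAffine n q :=
  RingQuot.mkAlgHom ℂ (QuantumRel n q) (FreeAlgebra.ι ℂ i)

theorem gen_mul_gen (n : ℕ) (q : ℂ) {i j : Fin n} (h : i < j) :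
    gen n q i * gen n q j = q • (gen n q j * gen n q i) := by
  have := RingQuot.mkAlgHom_rel ℂ (QuantumRel.comm (q := q) i j h)
  simpa [gen] using this

theorem hom_ext {n : ℕ} {q : ℂ} {B : Type*} [Semiring B] [Algebra ℂ B]
    {f g : QuantumAffine n q →ₐ[ℂ] B} (h : ∀ i, f (gen n q i) = g (gen n q i)) : f = g := by
  apply RingQuot.ringQuot_ext'
  ext i
  exact h i

theorem mul_pow_qcomm {B : Type*} [Ring B] [Algebra ℂ B] {q : ℂ} {a b : B}
    (h : a * b = q • (b * a)) (e : ℕ) : a * b ^ e = q ^ e • (b ^ e * a) := by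
  induction e with
  | zero => simp
  | succ e ih =>
    rw [pow_succ, ← mul_assoc, ih, smul_mul_assoc, mul_assoc, h, mul_smul_comm, smul_smul,
      ← mul_assoc, ← pow_succ, ← pow_succ]

theorem pow_mul_pow_qcomm {B : Type*} [Ring B] [Algebra ℂ B] {q : ℂ} {a b : B}
    (h : a * b = q • (b * a)) (e : ℕ) : a ^ e * b ^ e = q ^ (e ^ 2) • (b ^ e * a ^ e) := by
  have key : ∀ m : ℕ, a ^ m * b ^ e = (q ^ e) ^ m • (b ^ e * a ^ m) := by
    intro m
    induction m with
    | zero => simp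
    | succ m ih =>
      rw [pow_succ, mul_assoc, mul_pow_qcomm h, mul_smul_comm, ← mul_assoc, ih, smul_mul_assoc,
        smul_smul, mul_assoc, ← pow_succ, ← pow_succ']
  rw [key e, ← pow_mul, sq]

/-- For `n ≤ m` and `q = q' ^ (e ^ 2)`, the homomorphism given by `x_i ↦ x_i ^ e` for
`1 ≤ i ≤ n`. -/
noncomputable def powHom {n m : ℕ} (hnm : n ≤ m) {q q' : ℂ} (e : ℕ) (hq : q = q' ^ (e ^ 2)) :
    QuantumAffine n q →ₐ[ℂ] QuantumAffine m q' :=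
  RingQuot.liftAlgHom ℂ
    ⟨FreeAlgebra.lift ℂ fun i => gen m q' (Fin.castLE hnm i) ^ e, by
      rintro _ _ ⟨i, j, h⟩
      have h' : Fin.castLE hnm i < Fin.castLE hnm j := h
      simp only [map_mul, map_smul, FreeAlgebra.lift_ι_apply]
      rw [hq]
      exact pow_mul_pow_qcomm (gen_mul_gen m q' h') e⟩

@[simp]
theorem powHom_gen {n m : ℕ} (hnm : n ≤ m) {q q' : ℂ} (e : ℕ) (hq : q = q' ^ (e ^ 2))
    (i : Fin n) : powHom hnm e hq (gen n q i) = gen m q' (Fin.castLE hnm i) ^ e := by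
  simp [powHom, gen]

end QuantumAffine

/-- A compatible sequence of roots of unity: `r_t` is a primitive `p^{2t}`-th root of unity and
`r_t = r_{t+1}^{p^2}`, for all `t ≥ 1`. -/
structure RootTower (p : ℕ) where
  root : ℕ+ → ℂ
  isPrimitiveRoot : ∀ t : ℕ+, IsPrimitiveRoot (root t) (p ^ (2 * (t : ℕ)))
  root_eq : ∀ t : ℕ+, root t = root (t + 1) ^ (p ^ 2)

namespace RootTower

variable {p : ℕ} (R : RootTower p)

theorem root_eq_pow {t s : ℕ+} (h : t ≤ s) :
    R.root t = R.root s ^ ((p ^ ((s : ℕ) - (t : ℕ))) ^ 2) := by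
  have key : ∀ (d : ℕ) (s : ℕ+), (s : ℕ) = t + d → R.root t = R.root s ^ ((p ^ d) ^ 2) := by
    intro d
    induction d with
    | zero =>
      intro s hs
      have : s = t := PNat.eq (by simpa using hs)
      simp [this]
    | succ d ih =>
      intro s hs
      obtain ⟨u, hu⟩ : ∃ u : ℕ+, (u : ℕ) = t + d := ⟨⟨t + d, by positivity⟩, rfl⟩
      have hs' : s = u + 1 := PNat.eq (by rw [hs, PNat.add_coe, hu]; rfl)
      rw [ih u hu, R.root_eq, ← hs', ← pow_mul]
      congr 1
      ring
  refine key _ s ?_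
  have : (t : ℕ) ≤ s := h
  omega

/-- The algebra `A_{nt}`, for `n, t ≥ 1`; the index is the pair `(n, t)`. -/
abbrev Alg (R : RootTower p) (i : ℕ+ × ℕ+) : Type := QuantumAffine i.1 (R.root i.2)

/-- The embedding `Φ : A_{nt} → A_{n,t+1}`, `x_{it} ↦ x_{i,t+1}^p`. -/
noncomputable def Phi (n t : ℕ+) : R.Alg (n, t) →ₐ[ℂ] R.Alg (n, t + 1) :=
  QuantumAffine.powHom le_rfl p (R.root_eq t)

/-- The embedding `Ψ : A_{nt} → A_{n+1,t}`, `x_{it} ↦ x_{it}`. -/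
noncomputable def Psi (n t : ℕ+) : R.Alg (n, t) →ₐ[ℂ] R.Alg (n + 1, t) :=
  QuantumAffine.powHom (PNat.coe_le_coe _ _ |>.2 (PNat.lt_add_right n 1).le) 1 (by simp)

/-- The composite transition map `A_{nt} → A_{ms}` for `n ≤ m`, `t ≤ s`: it sends `x_{it}` to
`x_{is}^{p^{s-t}}`. -/
noncomputable def trans (i j : ℕ+ × ℕ+) (h : i ≤ j) : R.Alg i →ₐ[ℂ] R.Alg j :=
  QuantumAffine.powHom (PNat.coe_le_coe _ _ |>.2 h.1) (p ^ ((j.2 : ℕ) - (i.2 : ℕ))) (R.root_eq_pow h.2)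

theorem trans_gen (i j : ℕ+ × ℕ+) (h : i ≤ j) (a : Fin i.1) :
    R.trans i j h (QuantumAffine.gen i.1 (R.root i.2) a) =
      QuantumAffine.gen j.1 (R.root j.2) (Fin.castLE (PNat.coe_le_coe _ _ |>.2 h.1) a) ^ (p ^ ((j.2 : ℕ) - (i.2 : ℕ))) :=
  QuantumAffine.powHom_gen _ _ _ a

instance : DirectedSystem R.Alg (R.trans · · ·) where
  map_self i x := by
    have : R.trans i i le_rfl = AlgHom.id ℂ _ := QuantumAffine.hom_ext fun a => by
      rw [trans_gen, Nat.sub_self, pow_zero, pow_one]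
      rfl
    exact DFunLike.congr_fun this x
  map_map k j i hij hjk x := by
    have : (R.trans j k hjk).comp (R.trans i j hij) = R.trans i k (hij.trans hjk) :=
      QuantumAffine.hom_ext fun a => by
        have h1 : (i.2 : ℕ) ≤ j.2 := hij.2
        have h2 : (j.2 : ℕ) ≤ k.2 := hjk.2
        rw [AlgHom.comp_apply, trans_gen, map_pow, trans_gen, trans_gen, ← pow_mul, ← pow_add,
          show (k.2 : ℕ) - j.2 + (j.2 - i.2) = k.2 - i.2 by omega]
        rfl
    exact DFunLike.congr_fun this x

theorem trans_eq_Phi (n t : ℕ+) (h : (n, t) ≤ (n, t + 1)) :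
    R.trans (n, t) (n, t + 1) h = R.Phi n t :=
  QuantumAffine.hom_ext fun a => by
    rw [trans_gen]
    refine Eq.trans ?_ (QuantumAffine.powHom_gen _ _ _ a).symm
    rw [show p ^ (((t + 1 : ℕ+) : ℕ) - (t : ℕ)) = p by simp]

theorem trans_eq_Psi (n t : ℕ+) (h : (n, t) ≤ (n + 1, t)) :
    R.trans (n, t) (n + 1, t) h = R.Psi n t :=
  QuantumAffine.hom_ext fun a => by
    rw [trans_gen]
    refine Eq.trans ?_ (QuantumAffine.powHom_gen _ _ _ a).symm
    rw [show p ^ ((t : ℕ) - (t : ℕ)) = 1 by simp]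

/-- The algebra `A = ⋃_n A_n = ⋃_n ⋃_t A_{nt}`, where the algebras are identified along the
embeddings `Φ` and `Ψ`. -/
abbrev Union (R : RootTower p) : Type := DirectLimit R.Alg R.trans

/-- The canonical map `A_{nt} → A`. -/
noncomputable def toUnion (n t : ℕ+) : R.Alg (n, t) →ₐ[ℂ] R.Union :=
  DirectLimit.Algebra.of R.Alg R.trans (n, t)

/-- The subset `A_n = ⋃_t A_{nt}` of `A`. -/
def unionLevel (n : ℕ+) : Set R.Union := ⋃ t : ℕ+, Set.range (R.toUnion n t)

variable {D : Type*} [DivisionRing D] [Algebra ℂ D] (ι : R.Union →ₐ[ℂ] D)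

/-- The division subring `D_n` of `D` generated by (the image of) `A_n`. -/
def divLevel (n : ℕ+) : Subfield D := Subfield.closure (ι '' R.unionLevel n)

end RootTower

/-! Each $A_{nt}$ has the ordered monomials as a $\mathbb{C}$-basis (`monoBasis`), and a product of
monomials is a nonzero scalar times a monomial. Hence $A_{nt}$ is a domain and the transition maps
are injective. Since $r_t$ is a root of unity of some order $N$, each $x_i^N$ is central and
$A_{nt}$ is finite over its center, so every nonzero element has a nonzero central multiple
(`exists_mul_mem_center`). This gives the Ore condition, which passes to the directed union $A$.

Weak local finiteness: a finite subset of $D$ lies in the division ring generated by a single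
$A_{nt}$. Let $K$ be any division subring of the latter. A $Z(K)$-basis of $K$ stays independent
over the centralizer of $K$ in $D$ (`linearIndependent_centralizer`), while $K$ lies in the span of
finitely many monomials over that centralizer (`mem_span_centralizer`). So the basis is finite.

Center: write a central $d$ as $ab^{-1}$ with $a,b\in A_{nt}$. Conjugation by the generators of
$A_{n+1,s}$, $s\ge t$, scales each monomial of $A_{nt}$ by a power of $r_s^{p^{s-t}}$, a root of
unity of order $p^{s+t}$. As $s$ grows these weights separate the monomials (`eq_of_weights_eq`), so
$db=a$ can be compared term by term and $d$ is a scalar.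

The GK dimension is infinite because $D$ contains monomials in arbitrarily many variables. A
generator has powers independent over $\mathbb{C}=Z(D)$, which excludes algebraicity and local
finiteness. -/

/-! ### Monomial bases of quantum affine spaces -/

namespace QuantumAffine

/-- The product of the generators with indices in the list `l`. -/
noncomputable def word (n : ℕ) (q : ℂ) (l : List (Fin n)) : QuantumAffine n q :=
  (l.map (gen n q)).prod

/-- A monomial with prescribed multiset of factors. -/
noncomputable def mono (n : ℕ) (q : ℂ) (m : Multiset (Fin n)) : QuantumAffine n q :=
  word n q m.toList

variable {n : ℕ} {q : ℂ}

theorem word_cons (i : Fin n) (l : List (Fin n)) :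
    word n q (i :: l) = gen n q i * word n q l := by simp [word]

theorem word_append (l l' : List (Fin n)) :
    word n q (l ++ l') = word n q l * word n q l' := by simp [word]

theorem gen_mul_gen_sign (hq : q ≠ 0) (i j : Fin n) :
    gen n q i * gen n q j = q ^ Int.sign ((j : ℤ) - i) • (gen n q j * gen n q i) := by
  rcases lt_trichotomy i j with h | rfl | h
  · rw [Int.sign_eq_one_of_pos (by omega), zpow_one, gen_mul_gen n q h]
  · simp
  · rw [Int.sign_eq_neg_one_of_neg (by omega), zpow_neg_one, gen_mul_gen n q h, smul_smul,
      inv_mul_cancel₀ hq, one_smul]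

/-- Each adjacent swap costs a power of $q$. Only the nonvanishing of the scalar is ever needed, so
its value is not recorded. -/
theorem word_perm (hq : q ≠ 0) {l l' : List (Fin n)} (h : l.Perm l') :
    ∃ c : ℂ, c ≠ 0 ∧ word n q l = c • word n q l' := by
  induction h with
  | nil => exact ⟨1, one_ne_zero, by simp⟩
  | cons i _ ih =>
    obtain ⟨c, hc, h⟩ := ih
    exact ⟨c, hc, by rw [word_cons, word_cons, h, mul_smul_comm]⟩
  | swap i j l =>
    exact ⟨_, zpow_ne_zero _ hq, by
      rw [word_cons, word_cons, word_cons, word_cons, ← mul_assoc, gen_mul_gen_sign hq,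
        smul_mul_assoc, mul_assoc]⟩
  | trans _ _ ih₁ ih₂ =>
    obtain ⟨c, hc, h⟩ := ih₁
    obtain ⟨d, hd, h'⟩ := ih₂
    exact ⟨c * d, mul_ne_zero hc hd, by rw [h, h', smul_smul]⟩

theorem word_eq_smul_mono (hq : q ≠ 0) (l : List (Fin n)) :
    ∃ c : ℂ, c ≠ 0 ∧ word n q l = c • mono n q l :=
  word_perm hq (Multiset.coe_eq_coe.1 (Multiset.coe_toList _).symm)

theorem mono_mul_mono (hq : q ≠ 0) (m m' : Multiset (Fin n)) :
    ∃ c : ℂ, c ≠ 0 ∧ mono n q m * mono n q m' = c • mono n q (m + m') := by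
  obtain ⟨c, hc, h⟩ := word_eq_smul_mono hq (m.toList ++ m'.toList)
  refine ⟨c, hc, ?_⟩
  rw [mono, mono, ← word_append, h, ← Multiset.coe_add, Multiset.coe_toList, Multiset.coe_toList]

theorem span_word : Submodule.span ℂ (Set.range (word n q)) = ⊤ := by
  rw [eq_top_iff]
  have key : ∀ a : FreeAlgebra ℂ (Fin n), ∀ x ∈ Submodule.span ℂ (Set.range (word n q)),
      RingQuot.mkAlgHom ℂ (QuantumRel n q) a * x ∈ Submodule.span ℂ (Set.range (word n q)) := by
    intro a
    induction a using FreeAlgebra.induction with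
    | grade0 r =>
      intro x hx
      rw [AlgHom.commutes, ← Algebra.smul_def]
      exact Submodule.smul_mem _ _ hx
    | grade1 i =>
      intro x hx
      induction hx using Submodule.span_induction with
      | mem x hx =>
        obtain ⟨l, rfl⟩ := hx
        exact Submodule.subset_span ⟨i :: l, word_cons i l⟩
      | zero => simp
      | add x y _ _ hx hy => rw [mul_add]; exact add_mem hx hy
      | smul c x _ hx => rw [mul_smul_comm]; exact Submodule.smul_mem _ _ hx
    | mul a b ha hb => intro x hx; rw [map_mul, mul_assoc]; exact ha _ (hb _ hx)
    | add a b ha hb => intro x hx; rw [map_add, add_mul]; exact add_mem (ha _ hx) (hb _ hx)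
  intro x _
  obtain ⟨a, rfl⟩ := RingQuot.mkAlgHom_surjective ℂ (QuantumRel n q) x
  simpa using key a 1 (Submodule.subset_span ⟨[], by simp [word]⟩)

theorem span_mono (hq : q ≠ 0) : Submodule.span ℂ (Set.range (mono n q)) = ⊤ := by
  rw [eq_top_iff, ← span_word, Submodule.span_le]
  rintro _ ⟨l, rfl⟩
  obtain ⟨c, -, h⟩ := word_eq_smul_mono hq l
  rw [h]
  exact Submodule.smul_mem _ _ (Submodule.subset_span ⟨_, rfl⟩)

/-- The operator on the space with basis the commutative monomials through which `x_i` acts. -/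
noncomputable def genOp (n : ℕ) (q : ℂ) (i : Fin n) :
    Module.End ℂ (Multiset (Fin n) →₀ ℂ) :=
  -- To reach its place in the ordered monomial, $x_i$ passes the factors $x_a$ with $a<i$, and each
  -- passage $x_ix_a=q^{-1}x_ax_i$ costs $q^{-1}$.
  Finsupp.linearCombination ℂ fun m => Finsupp.single (i ::ₘ m) (q⁻¹ ^ m.countP (· < i))

theorem genOp_single (i : Fin n) (m : Multiset (Fin n)) (c : ℂ) :
    genOp n q i (Finsupp.single m c) =
      Finsupp.single (i ::ₘ m) (c * q⁻¹ ^ m.countP (· < i)) := by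
  simp [genOp]

/-- The representation of the quantum affine space on the space of commutative monomials. -/
noncomputable def rep (hq : q ≠ 0) :
    QuantumAffine n q →ₐ[ℂ] Module.End ℂ (Multiset (Fin n) →₀ ℂ) :=
  RingQuot.liftAlgHom ℂ ⟨FreeAlgebra.lift ℂ (genOp n q), by
    rintro _ _ ⟨i, j, h⟩
    simp only [map_mul, map_smul, FreeAlgebra.lift_ι_apply]
    refine Finsupp.lhom_ext fun m c => ?_
    rw [Module.End.mul_apply, LinearMap.smul_apply, Module.End.mul_apply, genOp_single,
      genOp_single, genOp_single, genOp_single, Finsupp.smul_single,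
      Multiset.countP_cons_of_neg (p := (· < i)) _ h.not_gt,
      Multiset.countP_cons_of_pos (p := (· < j)) _ h,
      Multiset.cons_swap]
    congr 1
    rw [pow_succ, smul_eq_mul]
    field_simp⟩

theorem rep_gen (hq : q ≠ 0) (i : Fin n) : rep hq (gen n q i) = genOp n q i := by
  simp [rep, gen]

theorem rep_word (hq : q ≠ 0) (l : List (Fin n)) :
    ∃ c : ℂ, c ≠ 0 ∧ rep hq (word n q l) (Finsupp.single 0 1) = Finsupp.single (l : Multiset _) c := by
  induction l with
  | nil => exact ⟨1, one_ne_zero, by simp [word]⟩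
  | cons i l ih =>
    obtain ⟨c, hc, h⟩ := ih
    refine ⟨c * q⁻¹ ^ (l : Multiset (Fin n)).countP (· < i),
      mul_ne_zero hc (pow_ne_zero _ (inv_ne_zero hq)), ?_⟩
    rw [word_cons, map_mul, Module.End.mul_apply, h, rep_gen, genOp_single, Multiset.cons_coe]

/-- Acting on the empty monomial through `rep` turns the monomials into nonzero multiples of
distinct basis vectors. -/
theorem linearIndependent_mono (hq : q ≠ 0) : LinearIndependent ℂ (mono n q) := by
  choose c hc h using fun m : Multiset (Fin n) => rep_word hq m.toList
  refine LinearIndependent.of_comp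
    ((LinearMap.applyₗ (Finsupp.single (0 : Multiset (Fin n)) (1 : ℂ))).comp
      (rep hq).toLinearMap) ?_
  have : (fun m => Finsupp.single m (c m)) = (fun m : Multiset (Fin n) =>
      (Units.mk0 (c m) (hc m)) • Finsupp.single m (1 : ℂ)) := by
    funext m; simp [Units.smul_def]
  convert_to LinearIndependent ℂ (fun m => Finsupp.single m (c m))
  · funext m
    have := h m
    rw [Multiset.coe_toList] at this
    exact this
  rw [this]
  exact (Finsupp.basisSingleOne (R := ℂ)).linearIndependent.units_smul _

/-- The basis of monomials. -/
noncomputable def monoBasis (hq : q ≠ 0) :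
    Module.Basis (Multiset (Fin n)) ℂ (QuantumAffine n q) :=
  Module.Basis.mk (linearIndependent_mono hq) (span_mono hq).ge

@[simp]
theorem monoBasis_apply (hq : q ≠ 0) (m : Multiset (Fin n)) : monoBasis hq m = mono n q m := by
  simp [monoBasis]

end QuantumAffine

/-! ### Zero divisors and central multiples -/

/-- Some pair of exponents from the two supports has a sum attained by no other pair, so its term in
the product cannot cancel. -/
theorem noZeroDivisors_of_basis {k B M : Type*} [Field k] [Ring B] [Algebra k B] [Add M]
    [UniqueSums M] (b : Module.Basis M k B)
    (h : ∀ m m', ∃ c : k, c ≠ 0 ∧ b m * b m' = c • b (m + m')) : NoZeroDivisors B := by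
  classical
  choose c hc h using h
  refine ⟨fun {f g} hfg => ?_⟩
  by_contra! hne
  obtain ⟨m₀, hm₀, m₁, hm₁, hu⟩ := UniqueSums.uniqueAdd_of_nonempty
    (A := (b.repr f).support) (B := (b.repr g).support)
    (by simpa [Finsupp.support_nonempty_iff] using hne.1)
    (by simpa [Finsupp.support_nonempty_iff] using hne.2)
  have hprod : f * g = ∑ m ∈ (b.repr f).support, ∑ m' ∈ (b.repr g).support,
      (b.repr f m * b.repr g m' * c m m') • b (m + m') := by
    conv_lhs => rw [← b.linearCombination_repr f, ← b.linearCombination_repr g]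
    rw [Finsupp.linearCombination_apply, Finsupp.linearCombination_apply, Finsupp.sum,
      Finsupp.sum, Finset.sum_mul_sum]
    refine Finset.sum_congr rfl fun m _ => Finset.sum_congr rfl fun m' _ => ?_
    rw [smul_mul_smul_comm, h, smul_smul]
  have hz : b.repr (f * g) (m₀ + m₁) = b.repr f m₀ * b.repr g m₁ * c m₀ m₁ := by
    rw [hprod]
    simp only [map_sum, map_smul, Module.Basis.repr_self, Finsupp.coe_finsetSum,
      Finset.sum_apply, Finsupp.smul_apply, smul_eq_mul]
    rw [Finset.sum_eq_single_of_mem m₀ hm₀, Finset.sum_eq_single_of_mem m₁ hm₁]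
    · simp
    · intro m' hm' hne'
      rw [Finsupp.single_eq_of_ne, mul_zero]
      exact fun e => hne' (hu hm₀ hm' e.symm).2
    · intro m hm hne'
      refine Finset.sum_eq_zero fun m' hm' => ?_
      rw [Finsupp.single_eq_of_ne, mul_zero]
      exact fun e => hne' (hu hm hm' e.symm).1
  rw [hfg, map_zero, Finsupp.zero_apply] at hz
  exact mul_ne_zero (mul_ne_zero (Finsupp.mem_support_iff.1 hm₀) (Finsupp.mem_support_iff.1 hm₁))
    (hc _ _) hz.symm

/-- In a domain that is integral over a central subring, every nonzero element divides a nonzero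
element of this subring. -/
theorem exists_mul_eq_algebraMap {Z B : Type*} [CommRing Z] [Ring B] [NoZeroDivisors B]
    [Nontrivial B] [Algebra Z B] {b : B} (hb : b ≠ 0) (hint : IsIntegral Z b) :
    ∃ (z : Z) (b' : B), algebraMap Z B z ≠ 0 ∧ b * b' = algebraMap Z B z ∧
      b' * b = algebraMap Z B z := by
  obtain ⟨f, hf, hfb⟩ := hint
  -- Write $f=gX+f(0)$. If $f(0)$ is nonzero in $B$, then $g(b)$ is the cofactor and $-f(0)$ the
  -- multiple; otherwise $b$ cancels from $g(b)b=0$ and the degree drops.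
  have key : ∀ (d : ℕ) (f : Polynomial Z), f.natDegree = d → f.Monic →
      Polynomial.aeval b f = 0 → ∃ (z : Z) (b' : B), algebraMap Z B z ≠ 0 ∧
        b * b' = algebraMap Z B z ∧ b' * b = algebraMap Z B z := by
    intro d
    induction d with
    | zero =>
      intro f hd hf h0
      rw [hf.natDegree_eq_zero.1 hd, map_one] at h0
      exact absurd h0 one_ne_zero
    | succ d ih =>
      intro f hd hf h0
      have hdec := Polynomial.divX_mul_X_add f
      have h1 : Polynomial.aeval b f.divX * b + algebraMap Z B (f.coeff 0) = 0 := by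
        rw [← h0]
        conv_rhs => rw [← hdec]
        simp
      by_cases hc : algebraMap Z B (f.coeff 0) = 0
      · rw [hc, add_zero] at h1
        have hmon : f.divX.Monic := by
          rw [Polynomial.Monic, Polynomial.leadingCoeff, Polynomial.natDegree_divX_eq_natDegree_tsub_one,
            Polynomial.coeff_divX, hd, Nat.add_sub_cancel, ← hd]
          exact hf
        refine ih f.divX ?_ hmon ((mul_eq_zero.1 h1).resolve_right hb)
        rw [Polynomial.natDegree_divX_eq_natDegree_tsub_one, hd, Nat.add_sub_cancel]
      · have hcomm : Commute b (Polynomial.aeval b f.divX) :=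
          (Polynomial.commute_X f.divX).map (Polynomial.aeval b) |>.symm |> fun h => by
            simpa using h.symm
        refine ⟨-f.coeff 0, Polynomial.aeval b f.divX, by simpa using hc, ?_, ?_⟩
        · rw [hcomm.eq, map_neg]; exact eq_neg_of_add_eq_zero_left h1
        · rw [map_neg]; exact eq_neg_of_add_eq_zero_left h1
  exact key _ f rfl hf hfb

/-! ### Quantum affine spaces at a root of unity -/

namespace QuantumAffine

variable {n : ℕ} {q : ℂ}

theorem noZeroDivisors (hq : q ≠ 0) : NoZeroDivisors (QuantumAffine n q) := by
  have : UniqueSums (Multiset (Fin n)) :=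
    UniqueSums.of_injective_addHom (Multiset.toFinsupp (α := Fin n)).toAddMonoidHom.toAddHom
      (Multiset.toFinsupp (α := Fin n)).injective inferInstance
  refine noZeroDivisors_of_basis (monoBasis hq) fun m m' => ?_
  simpa using mono_mul_mono hq m m'

theorem nontrivial (hq : q ≠ 0) : Nontrivial (QuantumAffine n q) :=
  (monoBasis hq).repr.toEquiv.nontrivial

theorem mono_ne_zero (hq : q ≠ 0) (m : Multiset (Fin n)) : mono n q m ≠ 0 :=
  have := nontrivial (n := n) hq
  (linearIndependent_mono hq).ne_zero m

theorem gen_pow_mem_center (hq : q ≠ 0) {N : ℕ} (hN : q ^ N = 1) (i : Fin n) :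
    gen n q i ^ N ∈ Subring.center (QuantumAffine n q) := by
  rw [Subring.mem_center_iff]
  have hgen : ∀ j, gen n q j * gen n q i ^ N = gen n q i ^ N * gen n q j := fun j => by
    rw [mul_pow_qcomm (gen_mul_gen_sign hq j i), ← zpow_natCast, ← zpow_mul, mul_comm,
      zpow_mul, zpow_natCast, hN, one_zpow, one_smul]
  intro b
  have hb : b ∈ Submodule.span ℂ (Set.range (word n q)) := by rw [span_word]; trivial
  induction hb using Submodule.span_induction with
  | mem x hx =>
    obtain ⟨l, rfl⟩ := hx
    induction l with
    | nil => simp [word]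
    | cons j l ih => rw [word_cons, mul_assoc, ih, ← mul_assoc, hgen, mul_assoc]
  | zero => simp
  | add x y _ _ hx hy => rw [add_mul, mul_add, hx, hy]
  | smul c x _ hx => rw [smul_mul_assoc, mul_smul_comm, hx]

theorem finite_setOf_count_lt (n N : ℕ) :
    {m : Multiset (Fin n) | ∀ i, m.count i < N}.Finite := by
  refine (Set.finite_Iic (N • (Finset.univ : Finset (Fin n)).val)).subset fun m hm => ?_
  rw [Set.mem_Iic, Multiset.le_iff_count]
  intro i
  rw [Multiset.count_nsmul, Multiset.count_univ, mul_one]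
  exact (hm i).le

theorem span_center_mono (hq : q ≠ 0) {N : ℕ} (hNpos : 0 < N) (hN : q ^ N = 1) :
    Submodule.span (Subring.center (QuantumAffine n q))
      (mono n q '' {m | ∀ i, m.count i < N}) = ⊤ := by
  set W := Submodule.span (Subring.center (QuantumAffine n q))
      (mono n q '' {m | ∀ i, m.count i < N}) with hW
  have hsmul : ∀ (c : ℂ) (x), x ∈ W → c • x ∈ W := fun c x hx => by
    rw [Algebra.smul_def]
    exact W.smul_mem (⟨_, Subring.mem_center_iff.2 fun y => (Algebra.commutes c y).symm⟩ :
      Subring.center _) hx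
  have key : ∀ (d : ℕ) (m : Multiset (Fin n)), m.card = d → mono n q m ∈ W := by
    intro d
    induction d using Nat.strong_induction_on with
    | _ d ih =>
      intro m hd
      by_cases hm : ∀ i, m.count i < N
      · exact Submodule.subset_span ⟨m, hm, rfl⟩
      push Not at hm
      -- Some $x_i$ occurs at least $N$ times: split off the central factor $x_i^N$ and use
      -- induction on the degree.
      obtain ⟨i, hi⟩ := hm
      obtain ⟨m', rfl⟩ := Multiset.le_iff_exists_add.1 (Multiset.le_count_iff_replicate_le.1 hi)
      have hm' : mono n q m' ∈ W := ih _ (by rw [← hd]; simp [hNpos]) m' rfl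
      obtain ⟨c, hc, h⟩ := word_eq_smul_mono hq (List.replicate N i ++ m'.toList)
      rw [← Multiset.coe_add, Multiset.coe_replicate, Multiset.coe_toList, word_append] at h
      have h2 : mono n q (Multiset.replicate N i + m') = c⁻¹ • (gen n q i ^ N * mono n q m') := by
        rw [eq_inv_smul_iff₀ hc, ← h, mono]
        simp [word]
      rw [h2]
      exact hsmul _ _ (W.smul_mem (⟨_, gen_pow_mem_center hq hN i⟩ : Subring.center _) hm')
  rw [eq_top_iff]
  intro x _
  have hx : x ∈ Submodule.span ℂ (Set.range (mono n q)) := by rw [span_mono hq]; trivial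
  induction hx using Submodule.span_induction with
  | mem x hx => obtain ⟨m, rfl⟩ := hx; exact key _ m rfl
  | zero => exact zero_mem _
  | add x y _ _ hx hy => exact add_mem (hx trivial) (hy trivial)
  | smul c x _ hx => exact hsmul c x (hx trivial)

/-- At a root of unity, every nonzero element has a nonzero central two-sided multiple. -/
theorem exists_mul_mem_center (hq : q ≠ 0) {N : ℕ} (hNpos : 0 < N) (hN : q ^ N = 1)
    {b : QuantumAffine n q} (hb : b ≠ 0) :
    ∃ b' z, z ∈ Subring.center (QuantumAffine n q) ∧ z ≠ 0 ∧ b * b' = z ∧ b' * b = z := by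
  have := noZeroDivisors (n := n) hq
  have := nontrivial (n := n) hq
  have : Module.Finite (Subring.center (QuantumAffine n q)) (QuantumAffine n q) :=
    ⟨Submodule.fg_def.2 ⟨_, (finite_setOf_count_lt n N).image _, span_center_mono hq hNpos hN⟩⟩
  obtain ⟨z, b', hz, h1, h2⟩ := exists_mul_eq_algebraMap hb
    (Algebra.IsIntegral.isIntegral (R := Subring.center (QuantumAffine n q)) b)
  exact ⟨b', z, z.2, hz, h1, h2⟩

theorem powHom_word {m : ℕ} (hnm : n ≤ m) {q' : ℂ} (e : ℕ) (hq : q = q' ^ (e ^ 2))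
    (l : List (Fin n)) : powHom hnm e hq (word n q l) =
      word m q' (l.flatMap fun i => List.replicate e (Fin.castLE hnm i)) := by
  induction l with
  | nil => simp [word]
  | cons i l ih =>
    rw [word_cons, map_mul, ih, powHom_gen, List.flatMap_cons, word_append]
    congr 1
    simp [word]

theorem powHom_mono {m : ℕ} (hnm : n ≤ m) {q' : ℂ} (hq' : q' ≠ 0) (e : ℕ) (hq : q = q' ^ (e ^ 2))
    (s : Multiset (Fin n)) : ∃ c : ℂ, c ≠ 0 ∧ powHom hnm e hq (mono n q s) =
      c • mono m q' (e • s.map (Fin.castLE hnm)) := by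
  rw [mono, powHom_word]
  obtain ⟨c, hc, h⟩ := word_eq_smul_mono hq'
    (s.toList.flatMap fun i => List.replicate e (Fin.castLE hnm i))
  refine ⟨c, hc, ?_⟩
  rw [h]
  congr 2
  conv_rhs => rw [← Multiset.coe_toList s]
  induction s.toList with
  | nil => simp
  | cons i l ih =>
    rw [List.flatMap_cons, ← Multiset.coe_add, ih, ← Multiset.cons_coe, Multiset.map_cons,
      ← Multiset.singleton_add, nsmul_add, Multiset.nsmul_singleton, Multiset.coe_replicate]

/-- Monomials go to nonzero multiples of distinct monomials, so the image of a basis is independent.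
-/
theorem powHom_injective {m : ℕ} (hnm : n ≤ m) {q' : ℂ} (hq' : q' ≠ 0) {e : ℕ} (he : e ≠ 0)
    (hq : q = q' ^ (e ^ 2)) : Function.Injective (powHom hnm e hq) := by
  have hq0 : q ≠ 0 := hq ▸ pow_ne_zero _ hq'
  choose c hc h using powHom_mono hnm hq' e hq
  have hinj : Function.Injective fun s : Multiset (Fin n) => e • s.map (Fin.castLE hnm) := by
    intro s s' hs
    refine Multiset.map_injective (Fin.castLE_injective hnm) (Multiset.ext.2 fun a => ?_)
    have := congrArg (Multiset.count a) hs
    simpa [Multiset.count_nsmul, he] using this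
  have hli : LinearIndependent ℂ fun s => powHom hnm e hq (mono n q s) := by
    have := ((linearIndependent_mono (n := m) hq').comp _ hinj).units_smul
      fun s => Units.mk0 (c s) (hc s)
    convert this using 2 with s
    simp [h, Units.smul_def]
  have := (monoBasis hq0).injective_constr_of_linearIndependent (R₂ := ℂ) hli
  have hconstr : (monoBasis hq0).constr ℂ (fun s => powHom hnm e hq (mono n q s)) =
      (powHom hnm e hq).toLinearMap := (monoBasis hq0).ext fun s => by
      rw [Module.Basis.constr_basis]; simp
  rwa [hconstr] at this

end QuantumAffine

/-! ### Division subrings, centralizers and weights -/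

section DivisionRing

variable {D : Type*} [DivisionRing D]

/-- The division subring generated by a right Ore subring consists of fractions. -/
theorem mem_subfieldClosure_iff_of_ore (B : Subring D)
    (hore : ∀ a ∈ B, ∀ b ∈ B, b ≠ 0 → ∃ c ∈ B, ∃ d ∈ B, c ≠ 0 ∧ a * c = b * d) (x : D) :
    x ∈ Subfield.closure (B : Set D) ↔ ∃ a ∈ B, ∃ b ∈ B, b ≠ 0 ∧ x = a * b⁻¹ := by
  constructor
  · intro hx
    induction hx using Subfield.closure_induction with
    | mem x hx => exact ⟨x, hx, 1, one_mem _, one_ne_zero, by simp⟩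
    | one => exact ⟨1, one_mem _, 1, one_mem _, one_ne_zero, by simp⟩
    | neg x _ ih =>
      obtain ⟨a, ha, b, hb, hb0, rfl⟩ := ih
      exact ⟨-a, neg_mem ha, b, hb, hb0, by rw [neg_mul]⟩
    | inv x _ ih =>
      obtain ⟨a, ha, b, hb, hb0, rfl⟩ := ih
      by_cases ha0 : a = 0
      · exact ⟨0, zero_mem _, 1, one_mem _, one_ne_zero, by simp [ha0]⟩
      · exact ⟨b, hb, a, ha, ha0, by rw [mul_inv_rev, inv_inv]⟩
    | add x y _ _ ihx ihy =>
      obtain ⟨a, ha, b, hb, hb0, rfl⟩ := ihx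
      obtain ⟨a', ha', b', hb', hb0', rfl⟩ := ihy
      -- A common right multiple $bc=b'd$ serves as common denominator.
      obtain ⟨c, hc, d, hd, hc0, h⟩ := hore b hb b' hb' hb0'
      have hbc : b * c ≠ 0 := mul_ne_zero hb0 hc0
      have hd0 : d ≠ 0 := by rintro rfl; exact hbc (by rw [h, mul_zero])
      refine ⟨a * c + a' * d, add_mem (mul_mem ha hc) (mul_mem ha' hd), b * c, mul_mem hb hc, hbc, ?_⟩
      rw [add_mul]
      congr 1
      · rw [mul_inv_rev, mul_assoc, mul_inv_cancel_left₀ hc0]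
      · rw [h, mul_inv_rev, mul_assoc, mul_inv_cancel_left₀ hd0]
    | mul x y _ _ ihx ihy =>
      obtain ⟨a, ha, b, hb, hb0, rfl⟩ := ihx
      obtain ⟨a', ha', b', hb', hb0', rfl⟩ := ihy
      -- The Ore condition moves the inner denominator to the right: $b^{-1}a'=dc^{-1}$.
      obtain ⟨c, hc, d, hd, hc0, h⟩ := hore a' ha' b hb hb0
      refine ⟨a * d, mul_mem ha hd, b' * c, mul_mem hb' hc, mul_ne_zero hb0' hc0, ?_⟩
      have h' : b⁻¹ * a' = d * c⁻¹ := by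
        rw [eq_mul_inv_iff_mul_eq₀ hc0, mul_assoc, h, inv_mul_cancel_left₀ hb0]
      rw [mul_inv_rev, mul_assoc, ← mul_assoc b⁻¹, h']
      simp only [mul_assoc]
  · rintro ⟨a, ha, b, hb, -, rfl⟩
    exact mul_mem (Subfield.subset_closure ha) (inv_mem (Subfield.subset_closure hb))

/-- A division subring and its centralizer are linearly disjoint over the center. -/
theorem eq_zero_of_sum_mul_eq_zero {K : Subfield D} {J : Type*} {e : J → D}
    (hcomm : ∀ j, ∀ k ∈ K, e j * k = k * e j)
    (hli : LinearIndependent (Subring.center K) e) (s : Finset J) :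
    ∀ κ : J → K, ∑ j ∈ s, (κ j : D) * e j = 0 → ∀ j ∈ s, κ j = 0 := by
  classical
  induction s using Finset.induction_on with
  | empty => simp
  | insert j₀ s hj₀ ih =>
    intro κ h
    rw [Finset.sum_insert hj₀] at h
    by_cases h0 : κ j₀ = 0
    · rw [h0, ZeroMemClass.coe_zero, zero_mul, zero_add] at h
      intro j hj
      rcases Finset.mem_insert.1 hj with rfl | hj
      exacts [h0, ih κ h j hj]
    exfalso
    -- Normalize the coefficient of $e_{j_0}$ to 1. Commuting the relation with $k\in K$ then
    -- removes that term, and the shorter relation forces the other coefficients to be central in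
    -- $K$.
    set κ' : J → K := fun j => (κ j₀)⁻¹ * κ j with hκ'
    have h' : e j₀ + ∑ j ∈ s, (κ' j : D) * e j = 0 := by
      have h0' : (κ j₀ : D) ≠ 0 := by simpa using h0
      have := congrArg (fun x => (κ j₀ : D)⁻¹ * x) h
      simp only [mul_add, Finset.mul_sum, mul_zero, inv_mul_cancel_left₀ h0'] at this
      rw [← this]
      congr 1
      refine Finset.sum_congr rfl fun j _ => ?_
      simp [hκ', mul_assoc]
    have hcen : ∀ j ∈ s, κ' j ∈ Subring.center K := by
      intro j hj
      rw [Subring.mem_center_iff]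
      intro k
      refine sub_eq_zero.1 (ih (fun j => k * κ' j - κ' j * k) ?_ j hj)
      have h1 : (k : D) * (e j₀ + ∑ j ∈ s, (κ' j : D) * e j) -
          (e j₀ + ∑ j ∈ s, (κ' j : D) * e j) * k = 0 := by rw [h']; simp
      rw [mul_add, add_mul, hcomm j₀ k k.2, add_sub_add_left_eq_sub, Finset.mul_sum,
        Finset.sum_mul, ← Finset.sum_sub_distrib] at h1
      rw [← h1]
      refine Finset.sum_congr rfl fun j _ => ?_
      push_cast
      rw [sub_mul, mul_assoc, mul_assoc, mul_assoc, hcomm j k k.2]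
    -- The default value 1 is the coefficient at $j_0\notin s$; it contradicts independence over the
    -- center.
    let z : J → Subring.center K := fun j =>
      if hj : j ∈ s then ⟨κ' j, hcen j hj⟩ else 1
    have h2 := linearIndependent_iff'.1 hli (insert j₀ s) z (by
      rw [Finset.sum_insert hj₀, ← h']
      congr 1
      · simp [z, hj₀]
      · refine Finset.sum_congr rfl fun j hj => ?_
        simp only [z, dif_pos hj]
        rfl) j₀ (Finset.mem_insert_self _ _)
    simp [z, hj₀] at h2

/-- The centralizer of a division subring, as a division subring. -/
def Subfield.centralizerOf (K : Subfield D) : Subfield D where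
  __ := Subring.centralizer (K : Set D)
  inv_mem' _ hx := Set.inv_mem_centralizer₀ hx

theorem Subfield.mem_centralizerOf {K : Subfield D} {x : D} :
    x ∈ K.centralizerOf ↔ ∀ k ∈ K, k * x = x * k :=
  Subring.mem_centralizer_iff

/-- Expand the coefficients, which lie in the centralizer, in a $Z(K)$-basis $e$ of it. Elements of
$K$ commute with the $e_j$, so regrouping gives a relation among the $e_j$ over $K$, to which
`eq_zero_of_sum_mul_eq_zero` applies. -/
theorem linearIndependent_centralizer {K : Subfield D} {I : Type*} {v : I → K}
    (hv : LinearIndependent (Subring.center K) v) :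
    LinearIndependent K.centralizerOf (fun i => (v i : D)) := by
  rw [linearIndependent_iff']
  intro s f hf i hi
  let C : Submodule (Subring.center K) D :=
    { carrier := K.centralizerOf
      add_mem' := add_mem
      zero_mem' := zero_mem _
      smul_mem' := fun c x hx => by
        refine mul_mem (Subfield.mem_centralizerOf.2 fun k hk => ?_) hx
        exact congrArg Subtype.val (Subring.mem_center_iff.1 c.2 ⟨k, hk⟩) }
  let e := Module.Basis.ofVectorSpace (Subring.center K) C
  have hli : LinearIndependent (Subring.center K) (fun j => (e j : D)) :=
    e.linearIndependent.map' C.subtype C.ker_subtype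
  let g : I → C := fun i => ⟨f i, (f i).2⟩
  classical
  let T := s.biUnion fun i => (e.repr (g i)).support
  have hg : ∀ i ∈ s, (f i : D) = ∑ j ∈ T, ((e.repr (g i) j : K) : D) * (e j : D) := by
    intro i hi
    have h1 := e.linearCombination_repr (g i)
    rw [Finsupp.linearCombination_apply, Finsupp.sum_of_support_subset (s := T) _
      (Finset.subset_biUnion_of_mem (fun i => (e.repr (g i)).support) hi) _ (by simp)] at h1
    have h2 := congrArg Subtype.val h1
    rw [AddSubmonoidClass.coe_finsetSum] at h2
    exact h2.symm
  have hsum : ∑ j ∈ T, ((∑ i ∈ s, (e.repr (g i) j : K) * v i : K) : D) * (e j : D) = 0 := by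
    rw [← hf]
    push_cast
    simp only [Finset.sum_mul]
    rw [Finset.sum_comm]
    refine Finset.sum_congr rfl fun i hi => ?_
    change _ = (f i : D) * (v i : D)
    rw [hg i hi, Finset.sum_mul]
    refine Finset.sum_congr rfl fun j _ => ?_
    rw [mul_assoc, mul_assoc, Subfield.mem_centralizerOf.1 (e j).2 (v i) (v i).2]
  have hz := eq_zero_of_sum_mul_eq_zero
    (fun j k hk => (Subfield.mem_centralizerOf.1 (e j).2 k hk).symm) hli T _ hsum
  have hzero : ∀ j ∈ T, e.repr (g i) j = 0 := fun j hj =>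
    linearIndependent_iff'.1 hv s (fun i => e.repr (g i) j) (hz j hj) i hi
  have := hg i hi
  rw [Finset.sum_eq_zero fun j hj => by rw [hzero j hj]; simp] at this
  exact Subtype.ext this

/-- A $Z(K)$-basis of $K$ is independent over the centralizer inside a finite dimensional space,
hence finite. The `y i` need not lie in $K$, which lets the criterion descend to arbitrary division
subrings. -/
theorem isCentrallyFinite_of_le_span (K : Subfield D) {I : Type*} [Finite I] (y : I → D)
    (h : ∀ x ∈ K, x ∈ Submodule.span K.centralizerOf (Set.range y)) : IsCentrallyFinite K := by
  let W := Submodule.span K.centralizerOf (Set.range y)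
  have : Module.Finite K.centralizerOf W := Module.Finite.span_of_finite _ (Set.finite_range y)
  let v := Module.Basis.ofVectorSpace (Subring.center K) K
  have hv := linearIndependent_centralizer v.linearIndependent
  have hw : LinearIndependent K.centralizerOf (fun i => (⟨v i, h _ (v i).2⟩ : W)) :=
    LinearIndependent.of_comp W.subtype hv
  have := hw.finite
  exact Module.Finite.of_basis v

/-- Vectors with distinct weights under conjugation by the family `u` are independent. -/
theorem eq_zero_of_sum_weight_eq_zero {k : Type*} [Field k] [Algebra k D] {J M : Type*}
    {u : J → D} {c : J → M → k} (hc : ∀ m m', (∀ j, c j m = c j m') → m = m') (s : Finset M) :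
    ∀ v : M → D, (∀ j, ∀ m ∈ s, u j * v m = c j m • (v m * u j)) → (∀ j, u j ≠ 0) →
      ∑ m ∈ s, v m = 0 → ∀ m ∈ s, v m = 0 := by
  classical
  induction s using Finset.induction_on with
  | empty => simp
  | insert m₀ s hm₀ ih =>
    intro v hv hu h
    rw [Finset.sum_insert hm₀] at h
    have hs : ∀ m ∈ s, v m = 0 := by
      intro m hm
      obtain ⟨j, hj⟩ : ∃ j, c j m ≠ c j m₀ := by
        by_contra! hcon
        exact hm₀ (hc m m₀ hcon ▸ hm)
      -- Subtracting $c_j(m_0)$ times the relation multiplied by $u_j$ on the right from the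
      -- relation multiplied by $u_j$ on the left eliminates $v_{m_0}$.
      have := ih (fun m => (c j m - c j m₀) • v m)
        (fun i m hm => by
          rw [mul_smul_comm, hv i m (Finset.mem_insert_of_mem hm), smul_mul_assoc, smul_comm]) hu
        (by
          have h1 : u j * (v m₀ + ∑ m ∈ s, v m) -
            c j m₀ • ((v m₀ + ∑ m ∈ s, v m) * u j) = 0 := by rw [h]; simp
          rw [mul_add, add_mul, hv j m₀ (Finset.mem_insert_self _ _), smul_add,
            add_sub_add_left_eq_sub, Finset.mul_sum, Finset.sum_mul, Finset.smul_sum,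
            ← Finset.sum_sub_distrib] at h1
          refine (mul_eq_zero.1 (?_ : _ * u j = 0)).resolve_right (hu j)
          rw [← h1, Finset.sum_mul]
          refine Finset.sum_congr rfl fun m hm => ?_
          rw [hv j m (Finset.mem_insert_of_mem hm), smul_mul_assoc, sub_smul]) m hm
      exact (smul_eq_zero.1 this).resolve_left (sub_ne_zero.2 hj)
    intro m hm
    rcases Finset.mem_insert.1 hm with rfl | hm
    · rwa [Finset.sum_eq_zero hs, add_zero] at h
    · exact hs m hm

/-- If `d * b = a` for combinations `a, b ≠ 0` of vectors with distinct weights, and `d` has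
weight zero, then `d` is a scalar. -/
theorem mem_range_algebraMap_of_weights {k : Type*} [Field k] [Algebra k D] {J M : Type*}
    {u : J → D} (hu : ∀ j, u j ≠ 0) {c : J → M → k}
    (hc : ∀ m m', (∀ j, c j m = c j m') → m = m')
    {y : M → D} (hy : ∀ m, y m ≠ 0) (hw : ∀ j m, u j * y m = c j m • (y m * u j)) {d : D}
    (hd : ∀ j, u j * d = d * u j) (α β : M →₀ k) (hβ : β ≠ 0)
    (h : d * Finsupp.linearCombination k y β = Finsupp.linearCombination k y α) :
    d ∈ Set.range (algebraMap k D) := by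
  classical
  have h0 : ∑ m ∈ α.support ∪ β.support, (d * (β m • y m) - α m • y m) = 0 := by
    rw [Finset.sum_sub_distrib, ← Finset.mul_sum, sub_eq_zero]
    rw [Finsupp.linearCombination_apply, Finsupp.linearCombination_apply,
      Finsupp.sum_of_support_subset (s := α.support ∪ β.support) _ Finset.subset_union_right _
        (by simp),
      Finsupp.sum_of_support_subset (s := α.support ∪ β.support) _ Finset.subset_union_left _
        (by simp)] at h
    exact h
  obtain ⟨m, hm⟩ := Finsupp.support_nonempty_iff.2 hβ
  -- Since $d$ commutes with every $u_j$, the vectors $dy_m$ and $y_m$ have the same weight. So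
  -- $d\beta_m y_m=\alpha_m y_m$ for each $m$, and $y_m$ cancels.
  have h1 := eq_zero_of_sum_weight_eq_zero hc _ (fun m => d * (β m • y m) - α m • y m)
    (fun j m _ => by
      simp only [mul_sub, sub_mul, smul_sub, mul_smul_comm, smul_mul_assoc]
      rw [← mul_assoc, hd, mul_assoc, hw, mul_smul_comm, mul_assoc, smul_comm (β m), smul_comm (α m)])
    hu h0 m
    (Finset.mem_union_right _ hm)
  have hβm := Finsupp.mem_support_iff.1 hm
  refine ⟨α m / β m, ?_⟩
  refine mul_right_cancel₀ (smul_ne_zero hβm (hy m)) ?_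
  rw [sub_eq_zero.1 h1, ← Algebra.smul_def, smul_smul, div_mul_cancel₀ _ hβm]

end DivisionRing

/-! ### Existence of the quotient division ring -/

theorem exists_quotientDivisionRing {A : Type} [Ring A] [Algebra ℂ A] (hA : IsOreDomain A) :
    ∃ (D : Type) (_ : DivisionRing D) (_ : Algebra ℂ D) (ι : A →ₐ[ℂ] D),
      IsQuotientDivisionRing (ι : A →+* D) := by
  obtain ⟨hdom, hore⟩ := hA
  have hO : Nonempty (OreLocalization.OreSet (nonZeroDivisors A)) := by
    rw [OreLocalization.nonempty_oreSet_iff_of_noZeroDivisors]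
    intro r s
    by_cases hr : r = 0
    · exact ⟨0, 1, by simp [hr]⟩
    obtain ⟨-, c, d, h, h0⟩ := hore r s hr (nonZeroDivisors.coe_ne_zero s)
    exact ⟨d, ⟨c, mem_nonZeroDivisors_of_ne_zero (left_ne_zero_of_mul h0)⟩, h⟩
  obtain ⟨_⟩ := hO
  let ι : A →ₐ[ℂ] OreLocalization (nonZeroDivisors A) A :=
    { OreLocalization.numeratorRingHom with commutes' := fun _ => rfl }
  have hinj : Function.Injective ι :=
    OreLocalization.numeratorHom_inj fun x hx => (mem_nonZeroDivisors_iff.1 hx).1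
  refine ⟨OreLocalization (nonZeroDivisors A) A, inferInstance, inferInstance, ι, hinj, ?_⟩
  intro d
  induction d using OreLocalization.ind with
  | _ r s =>
  have hs : ι s ≠ 0 := (map_ne_zero_iff ι hinj).2 (nonZeroDivisors.coe_ne_zero s)
  have hrs : ι s * OreLocalization.oreDiv r s = ι r := OreLocalization.mul_cancel
  by_cases hr : r = 0
  · refine ⟨0, 1, one_ne_zero, mul_left_cancel₀ hs ?_⟩
    rw [hrs, hr]
    simp
  -- Elements of the localization are left fractions $s^{-1}r$; the relation $rc=sd$ rewrites them
  -- as right fractions $dc^{-1}$.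
  obtain ⟨⟨c, d, h, h0⟩, -⟩ := hore r s hr (nonZeroDivisors.coe_ne_zero s)
  have hc : ι c ≠ 0 := (map_ne_zero_iff ι hinj).2 (right_ne_zero_of_mul h0)
  refine ⟨d, c, right_ne_zero_of_mul h0, mul_left_cancel₀ hs (mul_right_cancel₀ hc ?_)⟩
  change ι s * OreLocalization.oreDiv r s * ι c = ι s * (ι d * (ι c)⁻¹) * ι c
  rw [hrs, ← map_mul, h, map_mul, mul_assoc, mul_assoc, inv_mul_cancel₀ hc, mul_one]

/-! ### Division rings generated by quantum affine spaces; growth; exponent vectors -/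

namespace QuantumAffine

variable {n : ℕ} {q : ℂ}

/-- If $z=bb'=b'b$ is a nonzero central multiple of $b$, then $az=b(b'a)$ and $za=(ab')b$ are the
common multiples. -/
theorem isOreDomain (hq : q ≠ 0) {N : ℕ} (hNpos : 0 < N) (hN : q ^ N = 1) :
    IsOreDomain (QuantumAffine n q) := by
  have := noZeroDivisors (n := n) hq
  have := nontrivial (n := n) hq
  refine ⟨NoZeroDivisors.to_isDomain _, fun a b ha hb => ?_⟩
  obtain ⟨b', z, hz, hz0, h1, h2⟩ := exists_mul_mem_center hq hNpos hN hb
  rw [Subring.mem_center_iff] at hz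
  exact ⟨⟨z, b' * a, by rw [hz, ← h1, mul_assoc], mul_ne_zero ha hz0⟩,
    ⟨z, a * b', by rw [← hz, ← h2, mul_assoc], mul_ne_zero hz0 ha⟩⟩

section DivisionRing

variable {D : Type*} [DivisionRing D] [Algebra ℂ D] (φ : QuantumAffine n q →ₐ[ℂ] D)

theorem mem_closure_range_iff (hφ : Function.Injective φ) (hq : q ≠ 0) {N : ℕ} (hNpos : 0 < N)
    (hN : q ^ N = 1) (x : D) : x ∈ Subfield.closure (Set.range φ) ↔
      ∃ a b, b ≠ 0 ∧ x = φ a * (φ b)⁻¹ := by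
  have hore := (isOreDomain (n := n) hq hNpos hN).2
  have key := mem_subfieldClosure_iff_of_ore φ.range.toSubring (D := D) (by
    rintro _ ⟨a, rfl⟩ _ ⟨b, rfl⟩ hb0
    by_cases ha : a = 0
    · exact ⟨1, one_mem _, 0, zero_mem _, one_ne_zero, by simp [ha]⟩
    have hb : b ≠ 0 := by rintro rfl; exact hb0 (map_zero φ)
    obtain ⟨⟨c, d, h, h0⟩, -⟩ := hore a b ha hb
    refine ⟨φ c, ⟨c, rfl⟩, φ d, ⟨d, rfl⟩,
      (map_ne_zero_iff φ hφ).2 (right_ne_zero_of_mul h0), ?_⟩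
    change φ a * φ c = φ b * φ d
    rw [← map_mul, h, map_mul]) x
  refine key.trans ⟨?_, ?_⟩
  · rintro ⟨_, ⟨a, rfl⟩, _, ⟨b, rfl⟩, hb, rfl⟩
    exact ⟨a, b, fun h => hb (by rw [h]; exact map_zero φ), rfl⟩
  · rintro ⟨a, b, hb, rfl⟩
    exact ⟨_, ⟨a, rfl⟩, _, ⟨b, rfl⟩, (map_ne_zero_iff φ hφ).2 hb, rfl⟩

/-- Denominators can be made central: $ab^{-1}=z^{-1}(ab')$ with $z=b'b$. A central $z$ commutes
with the whole division ring generated by the image, hence with $K$, so only the finitely many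
monomials with exponents below $N$ are needed. -/
theorem mem_span_centralizer (hφ : Function.Injective φ) (hq : q ≠ 0) {N : ℕ} (hNpos : 0 < N)
    (hN : q ^ N = 1) {K : Subfield D} (hK : K ≤ Subfield.closure (Set.range φ)) {x : D}
    (hx : x ∈ Subfield.closure (Set.range φ)) :
    x ∈ Submodule.span K.centralizerOf
      (Set.range fun m : {m : Multiset (Fin n) | ∀ i, m.count i < N} => φ (mono n q m)) := by
  have := nontrivial (n := n) hq
  have hcent : ∀ z ∈ Subring.center (QuantumAffine n q), φ z ∈ K.centralizerOf := by
    intro z hz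
    rw [Subfield.mem_centralizerOf]
    intro k hk
    change Commute k (φ z)
    have hk' := hK hk
    clear hk
    induction hk' using Subfield.closure_induction with
    | mem x hx =>
      obtain ⟨a, rfl⟩ := hx
      exact (show Commute a z from Subring.mem_center_iff.1 hz a).map φ
    | one => exact Commute.one_left _
    | add x y _ _ hx hy => exact hx.add_left hy
    | neg x _ hx => exact hx.neg_left
    | inv x _ hx => exact hx.inv_left₀
    | mul x y _ _ hx hy => exact hx.mul_left hy
  obtain ⟨a, b, hb, rfl⟩ := (mem_closure_range_iff φ hφ hq hNpos hN x).1 hx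
  obtain ⟨b', z, hz, hz0, h1, h2⟩ := exists_mul_mem_center hq hNpos hN hb
  have hb0 : φ b ≠ 0 := (map_ne_zero_iff φ hφ).2 hb
  have hzz0 : φ z ≠ 0 := (map_ne_zero_iff φ hφ).2 hz0
  have hx' : φ a * (φ b)⁻¹ = (φ z)⁻¹ * φ (a * b') := by
    rw [eq_inv_mul_iff_mul_eq₀ hzz0, ← mul_assoc, mul_inv_eq_iff_eq_mul₀ hb0, ← map_mul, ← map_mul,
      mul_assoc, h2, Subring.mem_center_iff.1 hz]
  rw [hx']
  have hw : ∀ w : QuantumAffine n q, φ w ∈ Submodule.span K.centralizerOf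
      (Set.range fun m : {m : Multiset (Fin n) | ∀ i, m.count i < N} => φ (mono n q m)) := by
    intro w
    have hw : w ∈ Submodule.span (Subring.center (QuantumAffine n q))
      (mono n q '' {m | ∀ i, m.count i < N}) := by
      rw [span_center_mono hq hNpos hN]; trivial
    induction hw using Submodule.span_induction with
    | mem x hx =>
      obtain ⟨m, hm, rfl⟩ := hx
      exact Submodule.subset_span ⟨⟨m, hm⟩, rfl⟩
    | zero => rw [map_zero]; exact zero_mem _
    | add x y _ _ hx hy => rw [map_add]; exact add_mem hx hy
    | smul c x _ hx =>
      have : φ (c • x) = (⟨φ c, hcent c c.2⟩ : K.centralizerOf) • φ x := map_mul φ _ _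
      rw [this]
      exact Submodule.smul_mem _ _ hx
  exact Submodule.smul_mem _ (⟨(φ z)⁻¹, inv_mem (hcent z hz)⟩ : K.centralizerOf) (hw _)

theorem isCentrallyFinite_of_le_closure_range (hφ : Function.Injective φ) (hq : q ≠ 0) {N : ℕ}
    (hNpos : 0 < N) (hN : q ^ N = 1) {K : Subfield D}
    (hK : K ≤ Subfield.closure (Set.range φ)) : IsCentrallyFinite K :=
  have := (finite_setOf_count_lt n N).to_subtype
  isCentrallyFinite_of_le_span K _ fun _ hx => mem_span_centralizer φ hφ hq hNpos hN hK (hK hx)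

theorem linearIndependent_map_mono (hφ : Function.Injective φ) (hq : q ≠ 0) :
    LinearIndependent ℂ fun m => φ (mono n q m) :=
  (linearIndependent_mono hq).map' φ.toLinearMap (LinearMap.ker_eq_bot.2 hφ)

theorem mul_map_mono_of_mul_map_gen {u : D} {ζ : ℂ} (hζ : ζ ≠ 0) (ε : Fin n → ℤ)
    (h : ∀ i, u * φ (gen n q i) = ζ ^ ε i • (φ (gen n q i) * u)) (m : Multiset (Fin n)) :
    u * φ (mono n q m) = ζ ^ (m.map ε).sum • (φ (mono n q m) * u) := by
  have key : ∀ l : List (Fin n),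
      u * φ (word n q l) = ζ ^ (l.map ε).sum • (φ (word n q l) * u) := by
    intro l
    induction l with
    | nil => simp [word]
    | cons i l ih =>
      rw [word_cons, map_mul, ← mul_assoc, h, smul_mul_assoc, mul_assoc, ih, mul_smul_comm,
        smul_smul, List.map_cons, List.sum_cons, zpow_add₀ hζ, mul_assoc]
  have := key m.toList
  rwa [← Multiset.sum_coe, ← Multiset.map_coe, Multiset.coe_toList] at this

/-- For $V$ spanned by 1 and the generators, $V^{nk}$ contains the $(k+1)^n$ monomials with
exponents at most $k$. For $k\ge n$ one has $nk\le k^2$, so $\log_{nk}k^n\ge n/2$. This crude bound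
suffices because $n$ is arbitrary in the application. -/
theorem natCast_div_two_le_gelfandKirillovDim (hφ : Function.Injective φ) (hq : q ≠ 0) (hn : 0 < n) :
    (((n : ℝ) / 2 : ℝ) : EReal) ≤ gelfandKirillovDim ℂ D := by
  classical
  set V : Submodule ℂ D := Submodule.span ℂ (insert 1 (Set.range fun i => φ (gen n q i))) with hV
  have hVfg : V.FG := Submodule.fg_span ((Set.finite_range _).insert _)
  have h1 : (1 : D) ∈ V := Submodule.subset_span (Set.mem_insert _ _)
  have hword : ∀ (r : ℕ) (l : List (Fin n)), l.length ≤ r → φ (word n q l) ∈ V ^ r := by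
    intro r
    induction r with
    | zero =>
      intro l hl
      rw [List.length_eq_zero_iff.1 (Nat.le_zero.1 hl), pow_zero]
      simp [word]
    | succ r ih =>
      intro l hl
      rw [pow_succ']
      cases l with
      | nil =>
        rw [← one_mul (φ _)]
        exact Submodule.mul_mem_mul h1 (ih [] (by simp))
      | cons i l =>
        rw [word_cons, map_mul]
        exact Submodule.mul_mem_mul (Submodule.subset_span (Set.mem_insert_of_mem _ ⟨i, rfl⟩))
          (ih l (by simpa using hl))
  have hcard : ∀ k : ℕ, (k + 1) ^ n ≤ Module.finrank ℂ (V ^ (n * k) : Submodule ℂ D) := by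
    intro k
    have : Module.Finite ℂ (V ^ (n * k) : Submodule ℂ D) := Module.Finite.iff_fg.2 (hVfg.pow _)
    let g : (Fin n → Fin (k + 1)) → Multiset (Fin n) := fun f =>
      ∑ i, Multiset.replicate (f i) i
    have hcount : ∀ f i, (g f).count i = f i := by
      intro f i
      simp only [g, Multiset.count_sum', Multiset.count_replicate]
      simp
    have hg : Function.Injective g := fun f f' h =>
      funext fun i => Fin.ext (by rw [← hcount, ← hcount, h])
    have hlen : ∀ f, (g f).card ≤ n * k := by
      intro f
      simp only [g, Multiset.card_sum, Multiset.card_replicate]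
      calc ∑ i, (f i : ℕ) ≤ ∑ _i : Fin n, k := Finset.sum_le_sum fun i _ => Nat.lt_succ_iff.1 (f i).2
        _ = n * k := by simp
    have hli : LinearIndependent ℂ fun f => (⟨φ (mono n q (g f)), hword _ _ (by
        rw [Multiset.length_toList]; exact hlen f)⟩ : (V ^ (n * k) : Submodule ℂ D)) :=
      LinearIndependent.of_comp (V ^ (n * k) : Submodule ℂ D).subtype
        ((linearIndependent_map_mono φ hφ hq).comp g hg)
    simpa using hli.fintype_card_le_finrank
  refine le_iSup_of_le V (le_iSup_of_le h1 (le_iSup_of_le (Module.Finite.iff_fg.2 hVfg) ?_))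
  refine Filter.le_limsup_of_frequently_le' (Filter.frequently_atTop.2 fun N => ?_)
  -- This makes $nk\ge N$, $k\ge n$ and $k>1$ at once.
  set k := N + n + 1 with hk
  refine ⟨n * k, by nlinarith, EReal.coe_le_coe_iff.2 ?_⟩
  have hk1 : (1 : ℝ) < k := by rw [hk]; push_cast; have : (1 : ℝ) ≤ n := by exact_mod_cast hn
                               have : (0 : ℝ) ≤ N := by positivity
                               linarith
  have hn1 : (1 : ℝ) ≤ n := by exact_mod_cast hn
  have hr1 : (1 : ℝ) < ((n * k : ℕ) : ℝ) := by push_cast; nlinarith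
  have hdim : (k : ℝ) ^ n ≤ Module.finrank ℂ (V ^ (n * k) : Submodule ℂ D) := by
    have : (k : ℝ) ^ n ≤ ((k + 1) ^ n : ℕ) := by
      push_cast
      gcongr
      linarith
    exact this.trans (by exact_mod_cast hcard k)
  refine le_trans ?_ (Real.logb_le_logb_of_le hr1 (by positivity) hdim)
  rw [Real.le_logb_iff_rpow_le hr1 (by positivity)]
  have hrk : ((n * k : ℕ) : ℝ) ≤ (k : ℝ) ^ (2 : ℝ) := by
    rw [Real.rpow_two, sq]
    push_cast
    have : (n : ℝ) ≤ k := by exact_mod_cast (by omega : n ≤ k)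
    gcongr
  calc ((n * k : ℕ) : ℝ) ^ ((n : ℝ) / 2) ≤ ((k : ℝ) ^ (2 : ℝ)) ^ ((n : ℝ) / 2) := by gcongr
    _ = (k : ℝ) ^ n := by
      rw [← Real.rpow_mul (by positivity), mul_div_cancel₀ _ (two_ne_zero), Real.rpow_natCast]

end DivisionRing

/-- The additional index $j=n$ gives the total degree. It is needed: the $n\times n$ matrix of signs
is skew-symmetric, hence singular for odd $n$. This is why the center is tested with one more
variable. -/
theorem eq_of_sum_sign_eq {m m' : Multiset (Fin n)}
    (h : ∀ j : Fin (n + 1), (m.map fun i : Fin n => Int.sign ((i : ℤ) - j)).sum =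
      (m'.map fun i : Fin n => Int.sign ((i : ℤ) - j)).sum) : m = m' := by
  let δ : Fin n → ℤ := fun i => (m.count i : ℤ) - m'.count i
  have hsum : ∀ (m : Multiset (Fin n)) (f : Fin n → ℤ), (m.map f).sum = ∑ i, m.count i * f i := by
    intro m f
    rw [Finset.sum_multiset_map_count]
    simp only [nsmul_eq_mul]
    refine Finset.sum_subset (Finset.subset_univ _) fun i _ hi => ?_
    rw [Multiset.count_eq_zero.2 fun hm => hi (Multiset.mem_toFinset.2 hm)]
    simp
  have hδ : ∀ j : Fin (n + 1), ∑ i, δ i * Int.sign ((i : ℤ) - j) = 0 := by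
    intro j
    have := h j
    rw [hsum, hsum, ← sub_eq_zero, ← Finset.sum_sub_distrib] at this
    rw [← this]
    exact Finset.sum_congr rfl fun i _ => by simp only [δ]; ring
  have hall : ∑ i, δ i = 0 := by
    have := hδ (Fin.last n)
    rw [← neg_eq_zero, ← Finset.sum_neg_distrib] at this
    rw [← this]
    refine Finset.sum_congr rfl fun i _ => ?_
    rw [Int.sign_eq_neg_one_of_neg (by have := i.2; rw [Fin.val_last]; omega)]
    ring
  have hzero : ∀ (k : ℕ) (i : Fin n), (i : ℕ) = k → δ i = 0 := by
    intro k
    induction k using Nat.strong_induction_on with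
    | _ k ih =>
      intro i hi
      -- The factor is 2 for $i'<i$, 1 at $i'=i$ and 0 for $i'>i$, so the system is triangular.
      have h1 : ∑ i', δ i' * (1 - Int.sign ((i' : ℤ) - (i.castSucc : ℕ))) = 0 := by
        simp only [mul_sub, mul_one, Finset.sum_sub_distrib, hall, hδ i.castSucc, sub_self]
      rw [Finset.sum_eq_single i] at h1
      · simpa using h1
      · intro i' _ hne
        rcases lt_or_gt_of_ne hne with hlt | hgt
        · rw [ih i' (by rw [← hi]; exact hlt) i' rfl, zero_mul]
        · rw [Int.sign_eq_one_of_pos (by simp; omega), sub_self, mul_zero]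
      · simp
  refine Multiset.ext.2 fun i => ?_
  have := hzero i i rfl
  simp only [δ] at this
  omega

end QuantumAffine

/-! ### Elements with independent powers -/

section Powers

variable {D : Type*} [DivisionRing D]

theorem linearIndependent_center_of_range_algebraMap [Algebra ℂ D] {I : Type*} {v : I → D}
    (hZ : (Subring.center D : Set D) = Set.range (algebraMap ℂ D)) (hv : LinearIndependent ℂ v) :
    LinearIndependent (Subring.center D) v := by
  rw [linearIndependent_iff'] at hv ⊢
  intro s g hg i hi
  have : ∀ i, ∃ c : ℂ, algebraMap ℂ D c = g i := fun i => by
    have : (g i : D) ∈ (Subring.center D : Set D) := (g i).2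
    rwa [hZ] at this
  choose c hc using this
  have h0 := hv s c (by
    rw [← hg]
    refine Finset.sum_congr rfl fun i _ => ?_
    rw [Algebra.smul_def, hc]
    rfl) i hi
  exact Subtype.ext (by rw [← hc, h0, map_zero]; rfl)

theorem not_isAlgebraic_of_linearIndependent_pow {x : D}
    (hx : LinearIndependent (Subring.center D) fun i : ℕ => x ^ i) :
    ¬ Algebra.IsAlgebraic (Subring.center D) D := by
  rintro ⟨h⟩
  obtain ⟨f, hf, h0⟩ := h x
  rw [Polynomial.aeval_eq_sum_range] at h0
  refine hf (Polynomial.ext fun i => ?_)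
  by_cases hi : i ∈ Finset.range (f.natDegree + 1)
  · exact linearIndependent_iff'.1 hx _ f.coeff h0 i hi
  · exact Polynomial.coeff_eq_zero_of_natDegree_lt (by simpa using hi)

theorem not_isLocallyFinite_of_linearIndependent_pow {x : D}
    (hx : LinearIndependent (Subring.center D) fun i : ℕ => x ^ i) :
    ¬ IsLocallyFiniteDivisionRing D := by
  intro h
  have := h {x} (Set.finite_singleton x)
  have hmem : ∀ i : ℕ, x ^ i ∈ divisionClosureOverCenter ({x} : Set D) := fun i =>
    pow_mem (show x ∈ Subfield.closure ((Subring.center D : Set D) ∪ {x}) from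
      Subfield.subset_closure (Set.mem_union_right _ rfl)) i
  have hli : LinearIndependent (Subring.center D)
      fun i : ℕ => (⟨x ^ i, hmem i⟩ : divisionClosureOverCenter ({x} : Set D)) :=
    LinearIndependent.of_comp (divisionClosureOverCenter ({x} : Set D)).subtype hx
  exact not_finite_iff_infinite.2 inferInstance hli.finite

end Powers

/-! ### The union $A$ and its quotient division ring -/

namespace RootTower

variable {p : ℕ} (R : RootTower p)

theorem root_pow_eq_one (t : ℕ+) : R.root t ^ p ^ (2 * (t : ℕ)) = 1 :=
  (R.isPrimitiveRoot t).pow_eq_one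

theorem root_ne_zero (hp : p.Prime) (t : ℕ+) : R.root t ≠ 0 :=
  (R.isPrimitiveRoot t).ne_zero (pow_pos hp.pos _).ne'

theorem trans_injective (hp : p.Prime) (i j : ℕ+ × ℕ+) (h : i ≤ j) :
    Function.Injective (R.trans i j h) :=
  QuantumAffine.powHom_injective _ (R.root_ne_zero hp _) (pow_pos hp.pos _).ne' _

theorem toUnion_injective (hp : p.Prime) (n t : ℕ+) : Function.Injective (R.toUnion n t) :=
  DirectLimit.mk_injective _ (R.trans_injective hp) (n, t)

theorem toUnion_trans {n m t s : ℕ+} (h : (n, t) ≤ (m, s)) (x : R.Alg (n, t)) :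
    R.toUnion m s (R.trans (n, t) (m, s) h x) = R.toUnion n t x :=
  DirectLimit.Algebra.of_f (f := R.trans) h x

theorem range_toUnion_mono {n m t s : ℕ+} (hn : n ≤ m) (ht : t ≤ s) :
    Set.range (R.toUnion n t) ⊆ Set.range (R.toUnion m s) := by
  rintro _ ⟨x, rfl⟩
  exact ⟨_, R.toUnion_trans ⟨hn, ht⟩ x⟩

theorem exists_toUnion_eq₂ (a b : R.Union) :
    ∃ (n t : ℕ+) (x y : R.Alg (n, t)), a = R.toUnion n t x ∧ b = R.toUnion n t y := by
  obtain ⟨⟨n, t⟩, x, y, rfl, rfl⟩ := DirectLimit.exists_eq_mk₂ R.trans a b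
  exact ⟨n, t, x, y, rfl, rfl⟩

theorem isOreDomain_alg (hp : p.Prime) (n t : ℕ+) : IsOreDomain (R.Alg (n, t)) :=
  QuantumAffine.isOreDomain (R.root_ne_zero hp t) (pow_pos hp.pos _) (R.root_pow_eq_one t)

theorem isOreDomain_union (hp : p.Prime) : IsOreDomain R.Union := by
  have hnt : Nontrivial R.Union :=
    have := (R.isOreDomain_alg hp 1 1).1
    (R.toUnion_injective hp 1 1).nontrivial
  have hnz : NoZeroDivisors R.Union := by
    refine ⟨fun {a b} hab => ?_⟩
    obtain ⟨n, t, x, y, rfl, rfl⟩ := R.exists_toUnion_eq₂ a b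
    have := (R.isOreDomain_alg hp n t).1
    have hinj := R.toUnion_injective hp n t
    rw [← map_mul, map_eq_zero_iff _ hinj, mul_eq_zero] at hab
    rwa [map_eq_zero_iff _ hinj, map_eq_zero_iff _ hinj]
  refine ⟨NoZeroDivisors.to_isDomain _, fun a b ha hb => ?_⟩
  obtain ⟨n, t, x, y, rfl, rfl⟩ := R.exists_toUnion_eq₂ a b
  have hinj := R.toUnion_injective hp n t
  obtain ⟨⟨c, d, h1, h2⟩, ⟨c', d', h3, h4⟩⟩ := (R.isOreDomain_alg hp n t).2 x y
    (by rintro rfl; exact ha (map_zero _)) (by rintro rfl; exact hb (map_zero _))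
  exact ⟨⟨R.toUnion n t c, R.toUnion n t d, by rw [← map_mul, h1, map_mul],
      by rw [← map_mul]; exact (map_ne_zero_iff _ hinj).2 h2⟩,
    ⟨R.toUnion n t c', R.toUnion n t d', by rw [← map_mul, h3, map_mul],
      by rw [← map_mul]; exact (map_ne_zero_iff _ hinj).2 h4⟩⟩

theorem exists_mem_unionLevel₂ {n : ℕ+} {a b : R.Union} (ha : a ∈ R.unionLevel n)
    (hb : b ∈ R.unionLevel n) :
    ∃ (t : ℕ+) (x y : R.Alg (n, t)), a = R.toUnion n t x ∧ b = R.toUnion n t y := by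
  obtain ⟨t, ht⟩ := Set.mem_iUnion.1 ha
  obtain ⟨s, hs⟩ := Set.mem_iUnion.1 hb
  obtain ⟨x, hx⟩ := R.range_toUnion_mono le_rfl (le_max_left t s) ht
  obtain ⟨y, hy⟩ := R.range_toUnion_mono le_rfl (le_max_right t s) hs
  exact ⟨_, x, y, hx.symm, hy.symm⟩

theorem toUnion_mem_unionLevel (n t : ℕ+) (x : R.Alg (n, t)) :
    R.toUnion n t x ∈ R.unionLevel n :=
  Set.mem_iUnion.2 ⟨t, x, rfl⟩

theorem unionLevel_mono {n m : ℕ+} (h : n ≤ m) : R.unionLevel n ⊆ R.unionLevel m :=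
  Set.iUnion_mono fun _ => R.range_toUnion_mono h le_rfl

/-- `A_n`, as a subring of `A`. -/
def levelSubring (n : ℕ+) : Subring R.Union where
  carrier := R.unionLevel n
  zero_mem' := by rw [← map_zero (R.toUnion n 1)]; exact R.toUnion_mem_unionLevel n 1 0
  one_mem' := by rw [← map_one (R.toUnion n 1)]; exact R.toUnion_mem_unionLevel n 1 1
  add_mem' ha hb := by
    obtain ⟨t, x, y, rfl, rfl⟩ := R.exists_mem_unionLevel₂ ha hb
    rw [← map_add]
    exact R.toUnion_mem_unionLevel n t _
  mul_mem' ha hb := by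
    obtain ⟨t, x, y, rfl, rfl⟩ := R.exists_mem_unionLevel₂ ha hb
    rw [← map_mul]
    exact R.toUnion_mem_unionLevel n t _
  neg_mem' ha := by
    obtain ⟨t, x, rfl⟩ := Set.mem_iUnion.1 ha
    rw [← map_neg]
    exact R.toUnion_mem_unionLevel n t _

section DivisionRing

variable {D : Type*} [DivisionRing D] [Algebra ℂ D] (ι : R.Union →ₐ[ℂ] D)

/-- Any two elements of $A_n$ lie in a common $A_{nt}$, so $A_n$ inherits the right Ore condition.
-/
theorem mem_divLevel_iff (hp : p.Prime) (hι : Function.Injective ι) (n : ℕ+) (d : D) :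
    d ∈ divLevel R ι n ↔
      ∃ a ∈ R.unionLevel n, ∃ b ∈ R.unionLevel n, b ≠ 0 ∧ d = ι a * (ι b)⁻¹ := by
  refine (mem_subfieldClosure_iff_of_ore ((R.levelSubring n).map (ι : R.Union →+* D)) ?_ d).trans ?_
  · rintro _ ⟨a, ha, rfl⟩ _ ⟨b, hb, rfl⟩ hb0
    obtain ⟨t, x, y, rfl, rfl⟩ := R.exists_mem_unionLevel₂ ha hb
    by_cases hx : x = 0
    · exact ⟨1, one_mem _, 0, zero_mem _, one_ne_zero, by simp [hx]⟩
    obtain ⟨⟨c, d, h, h0⟩, -⟩ := (R.isOreDomain_alg hp n t).2 x y hx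
      (by rintro rfl; exact hb0 (by simp))
    refine ⟨_, ⟨_, R.toUnion_mem_unionLevel n t c, rfl⟩, _,
      ⟨_, R.toUnion_mem_unionLevel n t d, rfl⟩, ?_, ?_⟩
    · exact (map_ne_zero_iff ι hι).2
        ((map_ne_zero_iff _ (R.toUnion_injective hp n t)).2 (right_ne_zero_of_mul h0))
    · rw [← map_mul, ← map_mul, h, map_mul, map_mul]
  · constructor
    · rintro ⟨_, ⟨a, ha, rfl⟩, _, ⟨b, hb, rfl⟩, hb0, rfl⟩
      exact ⟨a, ha, b, hb, fun h => hb0 (by rw [h]; exact map_zero ι), rfl⟩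
    · rintro ⟨a, ha, b, hb, hb0, rfl⟩
      exact ⟨_, ⟨a, ha, rfl⟩, _, ⟨b, hb, rfl⟩, (map_ne_zero_iff ι hι).2 hb0, rfl⟩

/-- The embedding of `A_{nt}` in `D`. -/
noncomputable def embed (n t : ℕ+) : R.Alg (n, t) →ₐ[ℂ] D := ι.comp (R.toUnion n t)

theorem embed_injective (hp : p.Prime) (hι : Function.Injective ι) (n t : ℕ+) :
    Function.Injective (R.embed ι n t) :=
  hι.comp (R.toUnion_injective hp n t)

theorem embed_gen {n m t s : ℕ+} (hn : n ≤ m) (ht : t ≤ s) (i : Fin n) :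
    R.embed ι n t (QuantumAffine.gen n (R.root t) i) =
      R.embed ι m s (QuantumAffine.gen m (R.root s) (Fin.castLE hn i)) ^ p ^ ((s : ℕ) - t) := by
  rw [← map_pow]
  exact (congrArg ι (R.toUnion_trans ⟨hn, ht⟩ _).symm).trans
    (congrArg (R.embed ι m s) (R.trans_gen (n, t) (m, s) ⟨hn, ht⟩ i))

theorem range_embed_mono {n m t s : ℕ+} (hn : n ≤ m) (ht : t ≤ s) :
    Set.range (R.embed ι n t) ⊆ Set.range (R.embed ι m s) := by
  rintro _ ⟨x, rfl⟩
  exact ⟨_, congrArg ι (R.toUnion_trans ⟨hn, ht⟩ x)⟩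

theorem embed_gen_ne_zero (hp : p.Prime) (hι : Function.Injective ι) (n t : ℕ+) (i : Fin n) :
    R.embed ι n t (QuantumAffine.gen n (R.root t) i) ≠ 0 := by
  refine (map_ne_zero_iff _ (R.embed_injective ι hp hι n t)).2 ?_
  simpa [QuantumAffine.mono, QuantumAffine.word] using
    QuantumAffine.mono_ne_zero (R.root_ne_zero hp t) {i}

/-- Conjugation by a generator of level `(n + 1, s)`, `t ≤ s`, scales the monomials of level
`(n, t)`. -/
theorem embed_gen_mul_embed_mono (hp : p.Prime) (n t : ℕ+) (j : Fin (n + 1 : ℕ+)) (s : ℕ+)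
    (hs : t ≤ s) (m : Multiset (Fin n)) :
    R.embed ι (n + 1) s (QuantumAffine.gen _ (R.root s) j) *
        R.embed ι n t (QuantumAffine.mono n (R.root t) m) =
      (R.root s ^ p ^ ((s : ℕ) - t)) ^ (m.map fun i : Fin n => Int.sign ((i : ℤ) - j)).sum •
        (R.embed ι n t (QuantumAffine.mono n (R.root t) m) *
          R.embed ι (n + 1) s (QuantumAffine.gen _ (R.root s) j)) := by
  refine QuantumAffine.mul_map_mono_of_mul_map_gen _ (pow_ne_zero _ (R.root_ne_zero hp s)) _
    (fun i => ?_) m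
  have hn : n ≤ n + 1 := (PNat.lt_add_right n 1).le
  rw [R.embed_gen ι hn hs, ← map_pow, ← map_mul, ← map_mul, ← map_smul,
    QuantumAffine.mul_pow_qcomm (QuantumAffine.gen_mul_gen_sign (R.root_ne_zero hp s) _ _),
    ← zpow_natCast, ← zpow_natCast, ← zpow_mul, ← zpow_mul, mul_comm]
  rfl

theorem eq_of_weights_eq (hp : p.Prime) (n t : ℕ+) (m m' : Multiset (Fin n))
    (h : ∀ js : Fin (n + 1 : ℕ+) × {s : ℕ+ // t ≤ s},
      (R.root js.2 ^ p ^ ((js.2 : ℕ+) - t : ℕ)) ^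
          (m.map fun i : Fin n => Int.sign ((i : ℤ) - js.1)).sum =
        (R.root js.2 ^ p ^ ((js.2 : ℕ+) - t : ℕ)) ^
          (m'.map fun i : Fin n => Int.sign ((i : ℤ) - js.1)).sum) : m = m' := by
  refine QuantumAffine.eq_of_sum_sign_eq fun j => ?_
  generalize hE : (m.map fun i : Fin n => Int.sign ((i : ℤ) - j)).sum = E
  generalize hE' : (m'.map fun i : Fin n => Int.sign ((i : ℤ) - j)).sum = E'
  -- The weights at level $s$ determine the exponents $E,E'$ modulo $p^{s+t}$; this $s$ makes the
  -- modulus exceed $|E-E'|$.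
  obtain ⟨s, hs⟩ : ∃ s : ℕ+, (s : ℕ) = t + (E - E').natAbs :=
    ⟨⟨t + (E - E').natAbs, by positivity⟩, rfl⟩
  have hts : t ≤ s := PNat.coe_le_coe _ _ |>.1 (by omega)
  have h1 := h (j, ⟨s, hts⟩)
  dsimp only at h1
  rw [hE, hE'] at h1
  have hprim : IsPrimitiveRoot (R.root s ^ p ^ ((s : ℕ) - t)) (p ^ ((s : ℕ) + t)) :=
    (R.isPrimitiveRoot s).pow (pow_pos hp.pos _) (by rw [← pow_add]; congr 1; omega)
  have hz : R.root s ^ p ^ ((s : ℕ) - t) ≠ 0 := pow_ne_zero _ (R.root_ne_zero hp s)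
  have hdvd : ((p ^ ((s : ℕ) + t) : ℕ) : ℤ) ∣ E - E' := by
    rw [← hprim.zpow_eq_one_iff_dvd, zpow_sub₀ hz, h1, div_self (zpow_ne_zero _ hz)]
  refine sub_eq_zero.1 (Int.eq_zero_of_abs_lt_dvd hdvd ?_)
  rw [Int.abs_eq_natAbs]
  exact Int.ofNat_lt.2 ((Nat.lt_pow_self hp.one_lt).trans_le' (by omega))

theorem center_eq_range_algebraMap (hp : p.Prime)
    (hD : IsQuotientDivisionRing (ι : R.Union →+* D)) :
    (Subring.center D : Set D) = Set.range (algebraMap ℂ D) := by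
  obtain ⟨hι, hfrac⟩ := hD
  refine Set.Subset.antisymm (fun d hd => ?_) ?_
  · have hd' : ∀ x, x * d = d * x := Subring.mem_center_iff.1 hd
    obtain ⟨a, b, hb, hab⟩ := hfrac d
    obtain ⟨n, t, x, y, rfl, rfl⟩ := R.exists_toUnion_eq₂ a b
    have hq := R.root_ne_zero hp t
    have hy : y ≠ 0 := by rintro rfl; exact hb (map_zero _)
    have hy' : R.embed ι n t y ≠ 0 := (map_ne_zero_iff _ (R.embed_injective ι hp hι n t)).2 hy
    have hdy : d * R.embed ι n t y = R.embed ι n t x := by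
      rw [hab]
      exact inv_mul_cancel_right₀ hy' _
    have hrepr : ∀ z : R.Alg (n, t), Finsupp.linearCombination ℂ
        (fun m => R.embed ι n t (QuantumAffine.mono n (R.root t) m))
        ((QuantumAffine.monoBasis hq).repr z) = R.embed ι n t z := by
      intro z
      conv_rhs => rw [← (QuantumAffine.monoBasis hq).linearCombination_repr z]
      rw [Finsupp.linearCombination_apply, Finsupp.linearCombination_apply, map_finsuppSum]
      simp
    -- The test elements $u$ are the generators of all $A_{n+1,s}$ with $s\ge t$: the extra variable
    -- and the unbounded $s$ together separate the weights.
    refine mem_range_algebraMap_of_weights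
      (u := fun js : Fin (n + 1 : ℕ+) × {s : ℕ+ // t ≤ s} =>
        R.embed ι (n + 1) js.2 (QuantumAffine.gen _ (R.root js.2) js.1))
      (fun js => R.embed_gen_ne_zero ι hp hι _ _ _) (R.eq_of_weights_eq hp n t)
      (fun m => (map_ne_zero_iff _ (R.embed_injective ι hp hι n t)).2
        (QuantumAffine.mono_ne_zero hq m))
      (fun js m => R.embed_gen_mul_embed_mono ι hp n t js.1 js.2 js.2.2 m) (fun _ => hd' _)
      ((QuantumAffine.monoBasis hq).repr x) ((QuantumAffine.monoBasis hq).repr y)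
      (by simpa using hy) ?_
    rw [hrepr, hrepr, hdy]
  · rintro _ ⟨c, rfl⟩
    exact Subring.mem_center_iff.2 fun x => (Algebra.commutes c x).symm

theorem isWeaklyLocallyFinite (hp : p.Prime) (hD : IsQuotientDivisionRing (ι : R.Union →+* D)) :
    IsWeaklyLocallyFinite D := by
  obtain ⟨hι, hfrac⟩ := hD
  have hmono : ∀ {n m t s : ℕ+}, n ≤ m → t ≤ s →
      Subfield.closure (Set.range (R.embed ι n t)) ≤ Subfield.closure (Set.range (R.embed ι m s)) :=
    fun hn ht => Subfield.closure_mono (R.range_embed_mono ι hn ht)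
  intro S hS
  -- Finitely many fractions involve finitely many elements of $A$, all lying in one $A_{nt}$.
  obtain ⟨n, t, hK⟩ : ∃ n t : ℕ+, S ⊆ Subfield.closure (Set.range (R.embed ι n t)) := by
    induction S, hS using Set.Finite.induction_on with
    | empty => exact ⟨1, 1, Set.empty_subset _⟩
    | @insert d S _ _ ih =>
      obtain ⟨n, t, h⟩ := ih
      obtain ⟨a, b, hb, hab⟩ := hfrac d
      obtain ⟨m, s, x, y, rfl, rfl⟩ := R.exists_toUnion_eq₂ a b
      refine ⟨max n m, max t s, Set.insert_subset ?_
        (h.trans (hmono (le_max_left _ _) (le_max_left _ _)))⟩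
      refine hmono (le_max_right n m) (le_max_right t s) ?_
      rw [hab]
      exact mul_mem (Subfield.subset_closure ⟨x, rfl⟩)
        (inv_mem (Subfield.subset_closure ⟨y, rfl⟩))
  exact QuantumAffine.isCentrallyFinite_of_le_closure_range (R.embed ι n t)
    (R.embed_injective ι hp hι n t) (R.root_ne_zero hp t) (pow_pos hp.pos _) (R.root_pow_eq_one t)
    (Subfield.closure_le.2 hK)

theorem gelfandKirillovDim_eq_top (hp : p.Prime) (hι : Function.Injective ι) :
    gelfandKirillovDim ℂ D = ⊤ := by
  rw [EReal.eq_top_iff_forall_lt]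
  intro y
  obtain ⟨k, hk⟩ := exists_nat_gt (2 * y)
  -- With $k+1>2y$ variables the bound $(k+1)/2$ exceeds $y$; level $t=1$ is enough.
  refine lt_of_lt_of_le ?_ (QuantumAffine.natCast_div_two_le_gelfandKirillovDim
    (R.embed ι k.succPNat 1) (R.embed_injective ι hp hι _ 1) (R.root_ne_zero hp 1)
    k.succPNat.pos)
  rw [EReal.coe_lt_coe_iff, Nat.succPNat_coe]
  push_cast
  linarith

theorem linearIndependent_pow_gen (hp : p.Prime) (hι : Function.Injective ι) (n t : ℕ+)
    (i : Fin n) : LinearIndependent ℂ fun k : ℕ =>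
      R.embed ι n t (QuantumAffine.gen n (R.root t) i) ^ k := by
  have h := (QuantumAffine.linearIndependent_map_mono _ (R.embed_injective ι hp hι n t)
    (R.root_ne_zero hp t)).comp (fun k : ℕ => Multiset.replicate k i)
      (Multiset.replicate_left_injective i)
  convert h using 2 with k
  rw [Function.comp_apply, QuantumAffine.mono, ← map_pow]
  congr 1
  rw [QuantumAffine.word, List.eq_replicate_iff.2
    (⟨by simp, fun j hj => Multiset.eq_of_mem_replicate (Multiset.mem_toList.1 hj)⟩ :
      (Multiset.replicate k i).toList.length = k ∧ ∀ j ∈ (Multiset.replicate k i).toList, j = i)]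
  simp

end DivisionRing

end RootTower

theorem theorem6p1 (p : ℕ) (hp : p.Prime) (R : RootTower p) :
    -- `Φ` and `Ψ` are embeddings, and each `A_{nt}` embeds in `A`
    (∀ n t : ℕ+, Function.Injective (R.Phi n t) ∧ Function.Injective (R.Psi n t) ∧
      Function.Injective (R.toUnion n t)) ∧
    -- `A` is an Ore domain and has a quotient division ring
    IsOreDomain R.Union ∧
    (∃ (D : Type) (_ : DivisionRing D) (_ : Algebra ℂ D) (ι : R.Union →ₐ[ℂ] D),
      IsQuotientDivisionRing (ι : R.Union →+* D)) ∧
    -- for the quotient division ring `D` of `A`: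
    ∀ (D : Type*) [DivisionRing D] [Algebra ℂ D] (ι : R.Union →ₐ[ℂ] D),
      IsQuotientDivisionRing (ι : R.Union →+* D) →
      -- `D_n` consists of the fractions of elements of `A_n`, and `D` is the union of the `D_n`
      (∀ (n : ℕ+) (d : D), d ∈ RootTower.divLevel R ι n ↔
        ∃ a ∈ R.unionLevel n, ∃ b ∈ R.unionLevel n, b ≠ 0 ∧ d = ι a * (ι b)⁻¹) ∧
      (∀ n : ℕ+, RootTower.divLevel R ι n ≤ RootTower.divLevel R ι (n + 1)) ∧
      (∀ d : D, ∃ n : ℕ+, d ∈ RootTower.divLevel R ι n) ∧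
      -- the center of `D` is `ℂ`
      (Subring.center D : Set D) = Set.range (algebraMap ℂ D) ∧
      IsWeaklyLocallyFinite D ∧
      gelfandKirillovDim ℂ D = ⊤ ∧
      ¬ Algebra.IsAlgebraic (Subring.center D) D ∧
      ¬ IsLocallyFiniteDivisionRing D := by

  refine ⟨fun n t => ⟨?_, ?_, R.toUnion_injective hp n t⟩, R.isOreDomain_union hp,
    exists_quotientDivisionRing (R.isOreDomain_union hp), ?_⟩
  · exact QuantumAffine.powHom_injective _ (R.root_ne_zero hp _) hp.ne_zero _
  · exact QuantumAffine.powHom_injective _ (R.root_ne_zero hp _) one_ne_zero _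
  intro D _ _ ι hD
  have hlevel := R.mem_divLevel_iff ι hp hD.1
  have hcenter := R.center_eq_range_algebraMap ι hp hD
  -- The generator of $A_{11}$ is transcendental over $Z(D)=\mathbb{C}$, which settles both negative
  -- claims.
  have hpow := linearIndependent_center_of_range_algebraMap hcenter
    (R.linearIndependent_pow_gen ι hp hD.1 1 1 0)
  refine ⟨hlevel, fun n => ?_, fun d => ?_, hcenter, R.isWeaklyLocallyFinite ι hp hD,
    R.gelfandKirillovDim_eq_top ι hp hD.1, not_isAlgebraic_of_linearIndependent_pow hpow,
    not_isLocallyFinite_of_linearIndependent_pow hpow⟩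
  · exact Subfield.closure_mono
      (Set.image_mono (R.unionLevel_mono (PNat.lt_add_right n 1).le))
  · obtain ⟨a, b, hb, hab⟩ := hD.2 d
    obtain ⟨n, t, x, y, rfl, rfl⟩ := R.exists_toUnion_eq₂ a b
    exact ⟨n, (hlevel n d).2 ⟨_, R.toUnion_mem_unionLevel n t x, _,
      R.toUnion_mem_unionLevel n t y, hb, hab⟩⟩
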